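/- **Theorem 1.1.** Let $d_1\in\{1,2,3,4\}$. For every integer $d_2\ge 5$ let $X_{d_1,d_2}$ be a random variable having the $F$-distribution with $d_1$ numerator and $d_2$ denominator degrees of freedom, i.e. with density $$f(x)=\frac{1}{B(d_1/2,d_2/2)}\Big(\frac{d_1}{d_2}\Big)^{d_1/2}x^{d_1/2-1}\Big(1+\frac{d_1}{d_2}x\Big)^{-(d_1+d_2)/2}\quad(x>0),\qquad f(x)=0\quad(x\le 0),$$ where $B$ is the Beta function. Let $Z$ be a standard normal random variable and let $\Gamma_{d_1}$ be a $\chi^2(d_1)$ random variable. Then $X_{d_1,d_2}$ (for every integer $d_2\ge5$) and $\Gamma_{d_1}$ have finite variance, and $$P\left\{|X_{d_1,d_2}-E[X_{d_1,d_2}]|\le\sqrt{\mathrm{Var}(X_{d_1,d_2})}\right\}>P\{|Z|\le 1\}\qquad\text{for every integer } d_2\ge 5,$$ where $P\{|Z|\le 1\}\approx 0.6827$, precisely $\big|P\{|Z|\le1\}-0.6827\big|<5\cdot10^{-5}$. Moreover, $$\inf_{d_2\in\mathbb N,\ d_2\ge 5}P\left\{|X_{d_1,d_2}-E[X_{d_1,d_2}]|\le\sqrt{\mathrm{Var}(X_{d_1,d_2})}\right\}=P\left\{|\Gamma_{d_1}-E[\Gamma_{d_1}]|\le\sqrt{\mathrm{Var}(\Gamma_{d_1})}\right\}.$$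 -/

import Mathlib

open MeasureTheory ProbabilityTheory

/-- The `χ²(d)` distribution: the Gamma law with shape `d / 2` and rate `1 / 2`. -/
noncomputable def chiSquaredMeasure (d : ℕ) : Measure ℝ :=
  gammaMeasure ((d : ℝ) / 2) (1 / 2)

/-- The density of the `F`-distribution with `d₁` numerator and `d₂` denominator degrees of freedom:
`(d₁ / d₂) ^ (d₁ / 2) * x ^ (d₁ / 2 - 1) * (1 + d₁ x / d₂) ^ (-(d₁ + d₂) / 2) / B(d₁ / 2, d₂ / 2)`
for `x > 0`, and `0` otherwise. -/
noncomputable def fPDFReal (d₁ d₂ : ℕ) (x : ℝ) : ℝ :=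
  if 0 < x then
    1 / beta ((d₁ : ℝ) / 2) ((d₂ : ℝ) / 2) * ((d₁ : ℝ) / d₂) ^ ((d₁ : ℝ) / 2) *
      x ^ ((d₁ : ℝ) / 2 - 1) * (1 + (d₁ : ℝ) / d₂ * x) ^ (-(((d₁ : ℝ) + d₂) / 2))
  else 0

/-- The `F`-distribution with `d₁` and `d₂` degrees of freedom, as a measure on `ℝ`. -/
noncomputable def fMeasure (d₁ d₂ : ℕ) : Measure ℝ :=
  volume.withDensity (fun x => ENNReal.ofReal (fPDFReal d₁ d₂ x))

/-- The probability that the real random variable `X` lies within one standard deviation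
of its mean: `P(|X - E[X]| ≤ √Var(X))`. -/
noncomputable def probWithinOneSD {Ω : Type*} [MeasurableSpace Ω] (X : Ω → ℝ) (P : Measure Ω) : ℝ :=
  P.real {ω | |X ω - ∫ ω', X ω' ∂P| ≤ √(Var[X; P])}

/-!
In the coordinate `y = (d / n) * x` the `F`-distribution with `d` and `n` degrees of freedom is the
beta prime distribution with parameters `a = d / 2` and `b = n / 2`, so that the probability in
question is `F_b(u_n) - F_b(max l_n 0)`, where `F_b` is the beta prime distribution function and
`l_n < u_n` are the points one standard deviation away from the mean. The moments come from the
recursions of the Beta function, i.e. from integration by parts.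

This probability does not increase when `n` is replaced by `n + 2`. Integration by parts also gives
`F_{b + 1}(y) = F_b(y) + y ^ a * (1 + y) ^ (-(a + b)) / (b * B(a, b))`
(`betaPrimeCDF_add_one`), so `F_{b + 1}(u_{n + 2}) ≤ F_b(u_n)` amounts to a lower bound for the integral
of the kernel over `[u_{n + 2}, u_n]` from which the Beta function has disappeared. After minorising
one factor of the kernel by an affine function this integral is elementary
(`betaPrimeBoundary_le_mul_integral`). In terms of the coefficient of variation `r` at `n + 2` and
`s = d * r ^ 2 - 2`, which tends to `0` as `n` grows, there remains a polynomial inequality of the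
form `0 ≤ s ^ 2 * (p(s) + r * q(s))`; essentially all coefficients of `p` and `q` are nonnegative
(`boundary_ineq_one` to `boundary_ineq_four`). The lower endpoint matters only if `l_n > 0`, and
there a cruder estimate suffices (`betaPrimeCDF_fLower_le`).

As `n → ∞` the probabilities converge, by dominated convergence, to the corresponding probability
for `χ²(d)` (`tendsto_fProb`). Being the limit along both parities of nonincreasing sequences, the
latter is a lower bound and hence the infimum. It exceeds `0.683` by explicit primitives of
minorants of the density (`lt_chiSquaredProb`), whereas the standard normal probability is computed
to within `5 * 10 ^ (-5)` of `0.6827` by a Taylor polynomial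
(`abs_gaussianReal_within_one_sub_lt`).
-/

section

open Set Filter Topology

/-! ### The beta prime kernel and its distribution function -/

/-- The unnormalised density `y ^ (a - 1) * (1 + y) ^ (-(a + b))` of the beta prime distribution
with parameters `a` and `b`; only its values at `y > 0` matter. -/
noncomputable def betaPrimeKernel (a b y : ℝ) : ℝ := y ^ (a - 1) * (1 + y) ^ (-(a + b))

/-- The total mass of `betaPrimeKernel a b` on the positive half-line, i.e. the Beta function. -/
noncomputable def betaPrimeMass (a b : ℝ) : ℝ := ∫ y in Ioi 0, betaPrimeKernel a b y

/-- The distribution function at `y ≥ 0` of the beta prime distribution with parameters `a`, `b`. -/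
noncomputable def betaPrimeCDF (a b y : ℝ) : ℝ :=
  (∫ t in 0..y, betaPrimeKernel a b t) / betaPrimeMass a b

/-- The boundary term `y ^ a * (1 + y) ^ (-(a + b))` in the integration by parts which relates the
beta prime distributions with parameters `(a, b)`, `(a, b + 1)` and `(a + 1, b)`. -/
noncomputable def betaPrimeBoundary (a b y : ℝ) : ℝ := y ^ a * (1 + y) ^ (-(a + b))

lemma betaPrimeKernel_pos {a b y : ℝ} (hy : 0 < y) : 0 < betaPrimeKernel a b y := by
  unfold betaPrimeKernel; positivity

lemma betaPrimeBoundary_nonneg {a b y : ℝ} (hy : 0 ≤ y) : 0 ≤ betaPrimeBoundary a b y := by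
  unfold betaPrimeBoundary; positivity

lemma measurable_betaPrimeKernel (a b : ℝ) : Measurable (betaPrimeKernel a b) := by
  unfold betaPrimeKernel; fun_prop

lemma integrableOn_betaPrimeKernel {a b : ℝ} (ha : 0 < a) (hb : 0 < b) :
    IntegrableOn (betaPrimeKernel a b) (Ioi 0) := by
  rw [← Ioc_union_Ioi_eq_Ioi zero_le_one]
  refine IntegrableOn.union ?_ ?_
  · have h1 : IntegrableOn (fun y : ℝ => y ^ (a - 1)) (Ioc 0 1) :=
      (intervalIntegrable_iff_integrableOn_Ioc_of_le zero_le_one).1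
        (intervalIntegral.intervalIntegrable_rpow' (by linarith))
    refine Integrable.mono' h1 (measurable_betaPrimeKernel a b).aestronglyMeasurable ?_
    filter_upwards [ae_restrict_mem measurableSet_Ioc] with y hy
    have hy0 : 0 < y := hy.1
    rw [Real.norm_of_nonneg (betaPrimeKernel_pos hy0).le, betaPrimeKernel]
    exact mul_le_of_le_one_right (by positivity)
      (Real.rpow_le_one_of_one_le_of_nonpos (by linarith) (by linarith))
  · have h1 : IntegrableOn (fun y : ℝ => y ^ (-b - 1)) (Ioi 1) :=
      integrableOn_Ioi_rpow_of_lt (by linarith) one_pos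
    refine Integrable.mono' h1 (measurable_betaPrimeKernel a b).aestronglyMeasurable ?_
    filter_upwards [ae_restrict_mem measurableSet_Ioi] with y hy
    have hy0 : 0 < y := one_pos.trans hy
    rw [Real.norm_of_nonneg (betaPrimeKernel_pos hy0).le, betaPrimeKernel,
      show -b - 1 = (a - 1) + -(a + b) by ring, Real.rpow_add hy0]
    gcongr ?_ * ?_
    exact Real.rpow_le_rpow_of_nonpos hy0 (by linarith) (by linarith)

lemma intervalIntegrable_betaPrimeKernel {a b u v : ℝ} (ha : 0 < a) (hb : 0 < b) (hu : 0 ≤ u)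
    (hv : 0 ≤ v) : IntervalIntegrable (betaPrimeKernel a b) volume u v := by
  rw [intervalIntegrable_iff]
  exact (integrableOn_betaPrimeKernel ha hb).mono_set fun y hy =>
    lt_of_le_of_lt (le_min hu hv) hy.1

lemma betaPrimeMass_pos {a b : ℝ} (ha : 0 < a) (hb : 0 < b) : 0 < betaPrimeMass a b := by
  unfold betaPrimeMass
  rw [setIntegral_pos_iff_support_of_nonneg_ae]
  · have : Ioi (0 : ℝ) ⊆ Function.support (betaPrimeKernel a b) ∩ Ioi 0 :=
      fun y hy => ⟨(betaPrimeKernel_pos hy).ne', hy⟩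
    exact lt_of_lt_of_le (by simp) (measure_mono this)
  · filter_upwards [ae_restrict_mem measurableSet_Ioi] with y hy using (betaPrimeKernel_pos hy).le
  · exact integrableOn_betaPrimeKernel ha hb

lemma betaPrimeKernel_add {a b y : ℝ} (hy : 0 < y) :
    betaPrimeKernel a b y = betaPrimeKernel a (b + 1) y + betaPrimeKernel (a + 1) b y := by
  unfold betaPrimeKernel
  have h1 : (1 + y) ^ (-(a + b)) = (1 + y) ^ (-(a + (b + 1))) * (1 + y) := by
    rw [← Real.rpow_add_one (by positivity)]; congr 1; ring
  have h2 : y ^ (a + 1 - 1) = y ^ (a - 1) * y := by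
    rw [← Real.rpow_add_one hy.ne']; congr 1; ring
  rw [h1, h2, show -(a + 1 + b) = -(a + (b + 1)) by ring]; ring

lemma mul_betaPrimeKernel {a b y : ℝ} (hy : 0 < y) :
    y * betaPrimeKernel a b y = betaPrimeKernel (a + 1) (b - 1) y := by
  unfold betaPrimeKernel
  have h2 : y ^ (a + 1 - 1) = y ^ (a - 1) * y := by
    rw [← Real.rpow_add_one hy.ne']; congr 1; ring
  rw [h2, show -(a + 1 + (b - 1)) = -(a + b) by ring]; ring

lemma hasDerivAt_betaPrimeBoundary {a b y : ℝ} (hy : 0 < y) :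
    HasDerivAt (betaPrimeBoundary a b)
      (a * betaPrimeKernel a (b + 1) y - b * betaPrimeKernel (a + 1) b y) y := by
  have h1 : HasDerivAt (fun y : ℝ => y ^ a) (a * y ^ (a - 1)) y :=
    Real.hasDerivAt_rpow_const (Or.inl hy.ne')
  have h2 : HasDerivAt (fun y : ℝ => (1 + y) ^ (-(a + b)))
      (1 * -(a + b) * (1 + y) ^ (-(a + b) - 1)) y :=
    ((hasDerivAt_id y).const_add 1).rpow_const (Or.inl (by simp; positivity))
  refine (h1.mul h2).congr_deriv ?_
  unfold betaPrimeKernel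
  have h3 : (1 + y) ^ (-(a + b)) = (1 + y) ^ (-(a + b) - 1) * (1 + y) := by
    rw [← Real.rpow_add_one (by positivity)]; congr 1; ring
  have h4 : y ^ a = y ^ (a - 1) * y := by
    rw [← Real.rpow_add_one hy.ne']; congr 1; ring
  rw [h3, show a + 1 - 1 = a by ring, h4, show -(a + 1 + b) = -(a + b) - 1 by ring,
    show -(a + (b + 1)) = -(a + b) - 1 by ring]
  ring

lemma continuousOn_betaPrimeBoundary {a b : ℝ} (ha : 0 < a) :
    ContinuousOn (betaPrimeBoundary a b) (Ici 0) := by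
  intro y hy
  have hy : 0 ≤ y := hy
  unfold betaPrimeBoundary
  refine ContinuousAt.continuousWithinAt (ContinuousAt.mul ?_ ?_)
  · exact Real.continuousAt_rpow_const _ _ (Or.inr ha.le)
  · exact ContinuousAt.rpow_const (by fun_prop) (Or.inl (by positivity))

lemma betaPrimeBoundary_zero {a b : ℝ} (ha : 0 < a) : betaPrimeBoundary a b 0 = 0 := by
  simp [betaPrimeBoundary, Real.zero_rpow ha.ne']

lemma tendsto_betaPrimeBoundary_atTop {a b : ℝ} (ha : 0 < a) (hb : 0 < b) :
    Tendsto (betaPrimeBoundary a b) atTop (𝓝 0) := by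
  refine squeeze_zero' (g := fun y => y ^ (-b)) ?_ ?_ (tendsto_rpow_neg_atTop hb)
  · filter_upwards [eventually_ge_atTop 0] with y hy using betaPrimeBoundary_nonneg hy
  · filter_upwards [eventually_gt_atTop 0] with y hy
    rw [betaPrimeBoundary, show -b = a + -(a + b) by ring, Real.rpow_add hy]
    gcongr ?_ * ?_
    exact Real.rpow_le_rpow_of_nonpos hy (by linarith) (by linarith)

lemma integral_betaPrimeKernel_sub {a b y : ℝ} (ha : 0 < a) (hb : 0 < b) (hy : 0 ≤ y) :
    a * (∫ t in 0..y, betaPrimeKernel a (b + 1) t) - b * (∫ t in 0..y, betaPrimeKernel (a + 1) b t)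
      = betaPrimeBoundary a b y := by
  have i1 := intervalIntegrable_betaPrimeKernel (a := a) (b := b + 1) ha (by linarith) le_rfl hy
  have i2 := intervalIntegrable_betaPrimeKernel (a := a + 1) (b := b) (by linarith) hb le_rfl hy
  have := intervalIntegral.integral_eq_sub_of_hasDerivAt_of_le hy
    ((continuousOn_betaPrimeBoundary (b := b) ha).mono Icc_subset_Ici_self)
    (fun t ht => hasDerivAt_betaPrimeBoundary ht.1) ((i1.const_mul a).sub (i2.const_mul b))
  rw [betaPrimeBoundary_zero ha, sub_zero, intervalIntegral.integral_sub (i1.const_mul a)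
    (i2.const_mul b), intervalIntegral.integral_const_mul, intervalIntegral.integral_const_mul]
    at this
  exact this

lemma mul_betaPrimeMass_eq {a b : ℝ} (ha : 0 < a) (hb : 0 < b) :
    a * betaPrimeMass a (b + 1) = b * betaPrimeMass (a + 1) b := by
  have i1 := integrableOn_betaPrimeKernel (a := a) (b := b + 1) ha (by linarith)
  have i2 := integrableOn_betaPrimeKernel (a := a + 1) (b := b) (by linarith) hb
  have := integral_Ioi_of_hasDerivAt_of_tendsto
    ((continuousOn_betaPrimeBoundary (b := b) ha).continuousWithinAt self_mem_Ici)
    (fun t ht => hasDerivAt_betaPrimeBoundary ht) ((i1.const_mul a).sub (i2.const_mul b))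
    (tendsto_betaPrimeBoundary_atTop ha hb)
  rw [betaPrimeBoundary_zero ha, sub_zero, integral_sub (i1.const_mul a) (i2.const_mul b),
    integral_const_mul, integral_const_mul] at this
  unfold betaPrimeMass
  linarith

lemma betaPrimeMass_add {a b : ℝ} (ha : 0 < a) (hb : 0 < b) :
    betaPrimeMass a b = betaPrimeMass a (b + 1) + betaPrimeMass (a + 1) b := by
  unfold betaPrimeMass
  rw [← integral_add (integrableOn_betaPrimeKernel ha (by linarith))
    (integrableOn_betaPrimeKernel (by linarith) hb)]
  exact setIntegral_congr_fun measurableSet_Ioi fun y hy => betaPrimeKernel_add hy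

lemma betaPrimeMass_add_one {a b : ℝ} (ha : 0 < a) (hb : 0 < b) :
    (a + b) * betaPrimeMass a (b + 1) = b * betaPrimeMass a b := by
  rw [betaPrimeMass_add ha hb, add_mul, mul_betaPrimeMass_eq ha hb]; ring

/-- Raising the second parameter by one changes the beta prime distribution function by an explicit
elementary term. -/
lemma betaPrimeCDF_add_one {a b y : ℝ} (ha : 0 < a) (hb : 0 < b) (hy : 0 ≤ y) :
    betaPrimeCDF a (b + 1) y =
      betaPrimeCDF a b y + betaPrimeBoundary a b y / (b * betaPrimeMass a b) := by
  have hB := betaPrimeMass_pos ha hb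
  have hB1 := betaPrimeMass_pos (b := b + 1) ha (by linarith)
  have h1 := integral_betaPrimeKernel_sub ha hb hy
  have i1 := intervalIntegrable_betaPrimeKernel (a := a) (b := b + 1) ha (by linarith) le_rfl hy
  have i2 := intervalIntegrable_betaPrimeKernel (a := a + 1) (b := b) (by linarith) hb le_rfl hy
  have h2 : ∫ t in 0..y, betaPrimeKernel a b t = (∫ t in 0..y, betaPrimeKernel a (b + 1) t) +
      ∫ t in 0..y, betaPrimeKernel (a + 1) b t := by
    rw [← intervalIntegral.integral_add i1 i2, intervalIntegral.integral_of_le hy,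
      intervalIntegral.integral_of_le hy]
    exact setIntegral_congr_fun measurableSet_Ioc fun t ht => betaPrimeKernel_add ht.1
  have h3 := betaPrimeMass_add_one ha hb
  have h4 : betaPrimeMass a (b + 1) = b * betaPrimeMass a b / (a + b) := by
    field_simp; linarith
  unfold betaPrimeCDF
  rw [h4, h2, ← h1]
  field_simp
  ring

lemma betaPrimeCDF_sub {a b u v : ℝ} (ha : 0 < a) (hb : 0 < b) (hu : 0 ≤ u) (hv : 0 ≤ v) :
    betaPrimeCDF a b u - betaPrimeCDF a b v =
      (∫ t in v..u, betaPrimeKernel a b t) / betaPrimeMass a b := by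
  unfold betaPrimeCDF
  rw [← sub_div, intervalIntegral.integral_interval_sub_left
    (intervalIntegrable_betaPrimeKernel ha hb le_rfl hu)
    (intervalIntegrable_betaPrimeKernel ha hb le_rfl hv)]

lemma betaPrimeCDF_mono {a b u v : ℝ} (ha : 0 < a) (hb : 0 < b) (hv : 0 ≤ v) (huv : v ≤ u) :
    betaPrimeCDF a b v ≤ betaPrimeCDF a b u := by
  rw [← sub_nonneg, betaPrimeCDF_sub ha hb (hv.trans huv) hv]
  refine div_nonneg ?_ (betaPrimeMass_pos ha hb).le
  rw [intervalIntegral.integral_of_le huv]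
  exact setIntegral_nonneg measurableSet_Ioc fun t ht =>
    (betaPrimeKernel_pos (hv.trans_lt ht.1)).le

lemma betaPrimeCDF_zero (a b : ℝ) : betaPrimeCDF a b 0 = 0 := by simp [betaPrimeCDF]

lemma betaPrimeCDF_nonneg {a b u : ℝ} (ha : 0 < a) (hb : 0 < b) (hu : 0 ≤ u) :
    0 ≤ betaPrimeCDF a b u :=
  betaPrimeCDF_zero a b ▸ betaPrimeCDF_mono ha hb le_rfl hu

lemma betaPrimeCDF_add_one_le {a b u v : ℝ} (ha : 0 < a) (hb : 0 < b) (hu : 0 ≤ u) (hv : 0 ≤ v)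
    (h : betaPrimeBoundary a b v ≤ b * ∫ t in v..u, betaPrimeKernel a b t) :
    betaPrimeCDF a (b + 1) v ≤ betaPrimeCDF a b u := by
  have hB := betaPrimeMass_pos ha hb
  rw [betaPrimeCDF_add_one ha hb hv, ← le_sub_iff_add_le', betaPrimeCDF_sub ha hb hu hv,
    div_le_div_iff₀ (by positivity) hB]
  nlinarith

lemma le_betaPrimeCDF_add_one {a b u v : ℝ} (ha : 0 < a) (hb : 0 < b) (hu : 0 ≤ u) (hv : 0 ≤ v)
    (h : b * ∫ t in v..u, betaPrimeKernel a b t ≤ betaPrimeBoundary a b v) :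
    betaPrimeCDF a b u ≤ betaPrimeCDF a (b + 1) v := by
  have hB := betaPrimeMass_pos ha hb
  rw [betaPrimeCDF_add_one ha hb hv, ← sub_le_iff_le_add', betaPrimeCDF_sub ha hb hu hv,
    div_le_div_iff₀ hB (by positivity)]
  nlinarith

/-! ### Elementary bounds for beta prime integrals -/

lemma one_add_mul_add_sq_le_rpow {b e : ℝ} (hb : 2 ≤ b) (he : 0 ≤ e) :
    1 + b * e + b * (b - 1) / 2 * e ^ 2 ≤ (1 + e) ^ b := by
  have hd : ∀ x : ℝ, 0 ≤ x → HasDerivAt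
      (fun x : ℝ => (1 + x) ^ b - (1 + b * x + b * (b - 1) / 2 * x ^ 2))
      (b * (1 + x) ^ (b - 1) - (b + b * (b - 1) * x)) x := by
    intro x hx
    have h1 : HasDerivAt (fun x : ℝ => (1 + x) ^ b) (1 * b * (1 + x) ^ (b - 1)) x :=
      ((hasDerivAt_id x).const_add 1).rpow_const (Or.inl (by simp; positivity))
    have h2 : HasDerivAt (fun x : ℝ => 1 + b * x + b * (b - 1) / 2 * x ^ 2)
        (b * 1 + b * (b - 1) / 2 * (2 * x ^ 1 * 1)) x :=
      (((hasDerivAt_id x).const_mul b).const_add 1).add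
        (((hasDerivAt_id x).pow 2).const_mul (b * (b - 1) / 2))
    exact (h1.sub h2).congr_deriv (by ring)
  have hmono : MonotoneOn (fun x : ℝ => (1 + x) ^ b - (1 + b * x + b * (b - 1) / 2 * x ^ 2))
      (Ici 0) := by
    refine monotoneOn_of_deriv_nonneg (convex_Ici 0)
      (fun x hx => (hd x hx).continuousAt.continuousWithinAt) ?_ ?_
    · intro x hx
      rw [interior_Ici] at hx
      exact (hd x (le_of_lt hx)).differentiableAt.differentiableWithinAt
    · intro x hx
      rw [interior_Ici] at hx
      have hx : 0 < x := hx
      rw [(hd x hx.le).deriv]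
      have := one_add_mul_self_le_rpow_one_add (s := x) (by linarith) (p := b - 1) (by linarith)
      nlinarith
  have := hmono (a := 0) (b := e) self_mem_Ici he he
  norm_num at this
  linarith

/-- A lower bound for a beta prime integral. In the coordinate `x = y / (1 + y)` the factor
`x ^ (a - 1)` is minorised by an affine function with slope `g` (relative to the left endpoint),
after which the integral is elementary; the power of `(1 + u) / (1 + v)` which remains is
minorised by its second Taylor polynomial in `e`. -/
lemma betaPrimeBoundary_le_mul_integral {a b u v g e : ℝ} (ha : 0 < a) (hb : 2 ≤ b) (hv : 0 < v)
    (huv : v ≤ u) (hg : ∀ τ : ℝ, 1 ≤ τ → 1 + g * (τ - 1) ≤ τ ^ (a - 1))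
    (he : (1 + e) * (1 + v) = 1 + u)
    (hpos : 0 ≤ v * (b + 1) / (1 + v) + g)
    (hkey : v * (b + 1) + g * (b + 1 - b / (1 + e)) ≤
      (1 + b * e + b * (b - 1) / 2 * e ^ 2) * (v * (b + 1) / (1 + v) + g)) :
    betaPrimeBoundary a b v ≤ b * ∫ t in v..u, betaPrimeKernel a b t := by
  have hu : 0 < u := hv.trans_le huv
  have he0 : 0 ≤ e := by nlinarith
  set x := v / (1 + v) with hx
  have hx0 : 0 < x := by positivity
  set α := 1 + g / v with hα
  set β := g / x with hβ
  have hb1 : (0 : ℝ) < b + 1 := by linarith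
  have hb0 : (0 : ℝ) < b := by linarith
  let Ψ : ℝ → ℝ := fun y => x ^ (a - 1) *
    (-α / b * (1 + y) ^ (-b) + β / (b + 1) * (1 + y) ^ (-(b + 1)))
  let ψ : ℝ → ℝ := fun y => x ^ (a - 1) *
    (α * (1 + y) ^ (-b - 1) - β * (1 + y) ^ (-(b + 1) - 1))
  have hΨ : ∀ y ∈ uIcc v u, HasDerivAt Ψ (ψ y) y := by
    intro y hy
    rw [uIcc_of_le huv] at hy
    have hy0 : 0 < 1 + y := by linarith [hy.1]
    have h1 : ∀ p : ℝ, HasDerivAt (fun y : ℝ => (1 + y) ^ p) (1 * p * (1 + y) ^ (p - 1)) y :=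
      fun p => ((hasDerivAt_id y).const_add 1).rpow_const (Or.inl (by simpa using hy0.ne'))
    refine ((((h1 (-b)).const_mul (-α / b)).add
      ((h1 (-(b + 1))).const_mul (β / (b + 1)))).const_mul (x ^ (a - 1))).congr_deriv ?_
    simp only [ψ]
    field_simp
    ring
  have hψc : ContinuousOn ψ (uIcc v u) := by
    intro y hy
    rw [uIcc_of_le huv] at hy
    have hy0 : 0 < 1 + y := by linarith [hy.1]
    have h1 : ∀ p : ℝ, ContinuousAt (fun y : ℝ => (1 + y) ^ p) y :=
      fun p => ContinuousAt.rpow_const (by fun_prop) (Or.inl hy0.ne')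
    exact (((h1 _).const_mul α).sub ((h1 _).const_mul β)).const_mul (x ^ (a - 1))
      |>.continuousWithinAt
  have hle : ∀ y ∈ Icc v u, ψ y ≤ betaPrimeKernel a b y := by
    intro y hy
    have hy0 : 0 < y := hv.trans_le hy.1
    have h1 : (1 + y) ^ (-(b + 1) - 1) = (1 + y) ^ (-b - 1) * (1 + y)⁻¹ := by
      rw [← Real.rpow_neg_one (1 + y), ← Real.rpow_add (by positivity)]; congr 1; ring
    have h2 : betaPrimeKernel a b y =
        x ^ (a - 1) * ((1 + y) ^ (-b - 1) * (y / (1 + y) / x) ^ (a - 1)) := by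
      rw [Real.div_rpow (by positivity) hx0.le, Real.div_rpow hy0.le (by positivity),
        betaPrimeKernel, show -(a + b) = (-b - 1) - (a - 1) by ring]
      have : x ^ (a - 1) ≠ 0 := by positivity
      field_simp
      rw [← Real.rpow_add (by positivity)]
      congr 1
      ring
    have h3 : 1 ≤ y / (1 + y) / x := by
      rw [hx, le_div_iff₀ (by positivity), one_mul, div_le_div_iff₀ (by positivity) (by positivity)]
      nlinarith [hy.1]
    have h4 : α - β * (1 + y)⁻¹ = 1 + g * (y / (1 + y) / x - 1) := by
      rw [hα, hβ, hx]; field_simp; ring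
    simp only [ψ]
    rw [h1, h2, show α * (1 + y) ^ (-b - 1) - β * ((1 + y) ^ (-b - 1) * (1 + y)⁻¹) =
      (1 + y) ^ (-b - 1) * (α - β * (1 + y)⁻¹) by ring, h4]
    gcongr
    exact hg _ h3
  have hint : Ψ u - Ψ v ≤ ∫ t in v..u, betaPrimeKernel a b t := by
    rw [← intervalIntegral.integral_eq_sub_of_hasDerivAt hΨ hψc.intervalIntegrable]
    exact intervalIntegral.integral_mono_on huv hψc.intervalIntegrable
      (intervalIntegrable_betaPrimeKernel ha (by linarith) hv.le hu.le) hle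
  refine le_trans ?_ (mul_le_mul_of_nonneg_left hint hb0.le)
  set K := (1 + e) ^ (-b) with hK
  have hK0 : 0 < K := by positivity
  have hKL : K * (1 + b * e + b * (b - 1) / 2 * e ^ 2) ≤ 1 := by
    calc K * (1 + b * e + b * (b - 1) / 2 * e ^ 2) ≤ K * (1 + e) ^ b := by
          gcongr; exact one_add_mul_add_sq_le_rpow hb he0
      _ = 1 := by rw [hK, ← Real.rpow_add (by positivity)]; simp
  have hu1 : (1 + u) ^ (-b) = (1 + v) ^ (-b) * K := by
    rw [← he, Real.mul_rpow (by positivity) (by positivity)]; ring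
  have hsucc : ∀ y : ℝ, 0 < y → (1 + y) ^ (-(b + 1)) = (1 + y) ^ (-b) * (1 + y)⁻¹ := by
    intro y hy
    rw [← Real.rpow_neg_one (1 + y), ← Real.rpow_add (by positivity)]; congr 1; ring
  have hG : betaPrimeBoundary a b v = x ^ (a - 1) * (1 + v) ^ (-b) * x := by
    rw [betaPrimeBoundary, mul_assoc, mul_comm _ x, ← mul_assoc, ← Real.rpow_add_one hx0.ne', hx,
      sub_add_cancel, Real.div_rpow hv.le (by positivity), neg_add, Real.rpow_add (by positivity),
      Real.rpow_neg (by positivity) a]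
    ring
  have hfin : x ≤ α * (1 - K) - g / v * (b / (b + 1)) * (1 - K * (1 + e)⁻¹) := by
    have h1 := mul_le_mul_of_nonneg_left hkey hK0.le
    rw [← mul_assoc] at h1
    have h2 := h1.trans (mul_le_of_le_one_left hpos hKL)
    have h3 : α * (1 - K) - g / v * (b / (b + 1)) * (1 - K * (1 + e)⁻¹) - x =
        ((v * (b + 1) / (1 + v) + g) - K * (v * (b + 1) + g * (b + 1 - b / (1 + e)))) /
          (v * (b + 1)) := by
      rw [hα, hx]; field_simp; ring
    rw [← sub_nonneg, h3]
    exact div_nonneg (sub_nonneg.2 h2) (by positivity)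
  have hΨd : b * (Ψ u - Ψ v) = x ^ (a - 1) * (1 + v) ^ (-b) *
      (α * (1 - K) - g / v * (b / (b + 1)) * (1 - K * (1 + e)⁻¹)) := by
    simp only [Ψ]
    rw [hsucc u hu, hsucc v hv, hu1, ← he, hβ, hx]
    field_simp
    ring
  rw [hG, hΨd]
  gcongr

/-- An upper bound for a beta prime integral over `[v, u]`, from the value of the kernel's factors
at the endpoints. -/
lemma mul_integral_le_betaPrimeBoundary {a b u v : ℝ} (ha : 1 ≤ a) (ha2 : a ≤ 2) (hb : 0 < b)
    (hv : 0 < v) (huv : v ≤ u) (h : b * (u - v) * u ≤ v ^ 2) :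
    b * ∫ t in v..u, betaPrimeKernel a b t ≤ betaPrimeBoundary a b v := by
  have hu : 0 < u := hv.trans_le huv
  have hle : ∀ y ∈ Icc v u, betaPrimeKernel a b y ≤ u * v ^ (a - 2) * (1 + v) ^ (-(a + b)) := by
    intro y hy
    have hy0 : 0 < y := hv.trans_le hy.1
    have h1 : y ^ (a - 1) ≤ u * v ^ (a - 2) := by
      rw [show a - 1 = 1 + (a - 2) by ring, Real.rpow_add hy0, Real.rpow_one]
      exact mul_le_mul hy.2 (Real.rpow_le_rpow_of_nonpos hv hy.1 (by linarith)) (by positivity)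
        hu.le
    have h2 : (1 + y) ^ (-(a + b)) ≤ (1 + v) ^ (-(a + b)) :=
      Real.rpow_le_rpow_of_nonpos (by positivity) (by linarith [hy.1]) (by linarith)
    exact mul_le_mul h1 h2 (by positivity) (by positivity)
  have hint := intervalIntegral.integral_mono_on huv
    (intervalIntegrable_betaPrimeKernel (by linarith) hb hv.le hu.le)
    intervalIntegrable_const hle
  rw [intervalIntegral.integral_const, smul_eq_mul] at hint
  refine (mul_le_mul_of_nonneg_left hint hb.le).trans ?_
  have h3 : betaPrimeBoundary a b v = v ^ 2 * (v ^ (a - 2) * (1 + v) ^ (-(a + b))) := by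
    rw [betaPrimeBoundary, ← mul_assoc, ← Real.rpow_natCast v 2, ← Real.rpow_add hv]
    congr 2; push_cast; ring
  rw [h3, show b * ((u - v) * (u * v ^ (a - 2) * (1 + v) ^ (-(a + b)))) =
    b * (u - v) * u * (v ^ (a - 2) * (1 + v) ^ (-(a + b))) by ring]
  gcongr

/-! ### Polynomial inequalities at the upper endpoint -/

/-- The hypotheses of `betaPrimeBoundary_le_mul_integral` for `d = 1` with slope `g = -1 / 2`, at
`v = fUpper 1 (n + 2)` and a lower bound `u` of `fUpper 1 n`, all expressed through
`r = fCoeffVar 1 (n + 2)`. -/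
lemma boundary_ineq_one {r s b u v e : ℝ} (hr : 0 < r) (hs : 0 < s) (hs' : s = r ^ 2 - 2)
    (hb : b = (1 + r ^ 2) / s) (hv : v = s * (1 + r) / (2 * (1 + r ^ 2)))
    (hu : u = s * (1 + r + s ^ 2 / 9) / 6) (he : (1 + e) * (1 + v) = 1 + u) :
    0 ≤ v * (b + 1) / (1 + v) + (-1 / 2) ∧
    v * (b + 1) + (-1 / 2) * (b + 1 - b / (1 + e)) ≤
      (1 + b * e + b * (b - 1) / 2 * e ^ 2) * (v * (b + 1) / (1 + v) + (-1 / 2)) := by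
  obtain ⟨q, hq⟩ : ∃ q, q = 1 + r ^ 2 := ⟨_, rfl⟩
  obtain ⟨w, hw⟩ : ∃ w, w = 1 + r := ⟨_, rfl⟩
  obtain ⟨T, hT⟩ : ∃ T, T = 2 * q + s * w := ⟨_, rfl⟩
  obtain ⟨A, hA⟩ : ∃ A, A = w + s * q / 9 := ⟨_, rfl⟩
  have hq0 : 0 < q := by rw [hq]; positivity
  have hw0 : 0 < w := by rw [hw]; positivity
  have hT0 : 0 < T := by rw [hT]; positivity
  have hA0 : 0 < A := by rw [hA]; positivity
  rw [← hq] at hb hv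
  rw [← hw] at hv hu
  have hqs : q = s + 3 := by rw [hq, hs']; ring
  have h1v : 1 + v = T / (2 * q) := by rw [hv, hT]; field_simp
  have h1e : 1 + e = (3 * T + s ^ 2 * A) / (3 * T) := by
    have : 1 + e = (1 + u) / (1 + v) := by rw [← he, mul_div_cancel_right₀]; rw [h1v]; positivity
    rw [this, h1v, hu, hT, hA, hqs]; field_simp; ring
  have he' : e = s ^ 2 * A / (3 * T) := by
    have : e = (1 + e) - 1 := by ring
    rw [this, h1e]; field_simp; ring
  have hvb : v * (b + 1) = w * (q + s) / (2 * q) := by rw [hv, hb]; field_simp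
  have hvb' : v * (b + 1) / (1 + v) = w * (q + s) / T := by rw [hvb, h1v]; field_simp
  have hbe : b * (b - 1) = q * 3 / s ^ 2 := by rw [hb, hqs]; field_simp; ring
  rw [hvb', hvb, hbe, h1e, he', hb]
  constructor
  · have : w * (q + s) / T + -1 / 2 = (2 * r * q + s * w) / (2 * T) := by
      rw [hT, hw]; field_simp; ring
    rw [this]; positivity
  · rw [← sub_nonneg]
    have key : (1 + q / s * (s ^ 2 * A / (3 * T)) + q * 3 / s ^ 2 / 2 * (s ^ 2 * A / (3 * T)) ^ 2) *
          (w * (q + s) / T + -1 / 2) -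
        (w * (q + s) / (2 * q) +
          -1 / 2 * (q / s + 1 - q / s / ((3 * T + s ^ 2 * A) / (3 * T)))) =
        ((6 * T ^ 2 + 2 * q * s * A * T + q * s ^ 2 * A ^ 2) * (2 * w * (q + s) - T) * q *
            (3 * T + s ^ 2 * A) - 6 * T ^ 3 * (w * (q + s) * (3 * T + s ^ 2 * A) -
              q * (3 * T + s ^ 2 * A + q * s * A))) /
          (12 * q * T ^ 3 * (3 * T + s ^ 2 * A)) := by
      field_simp
      ring
    rw [key]
    refine div_nonneg ?_ (by positivity)
    have : (6 * T ^ 2 + 2 * q * s * A * T + q * s ^ 2 * A ^ 2) * (2 * w * (q + s) - T) * q *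
            (3 * T + s ^ 2 * A) - 6 * T ^ 3 * (w * (q + s) * (3 * T + s ^ 2 * A) -
              q * (3 * T + s ^ 2 * A + q * s * A)) =
        s ^ 2 * ((5832 + 19602 * s + 28647 * s ^ 2 + 23715 * s ^ 3 + 12282 * s ^ 4 +
          4240 * s ^ 5 + 1047 * s ^ 6 + 1798/9 * s ^ 7 + 814/27 * s ^ 8 + 268/81 * s ^ 9 +
          50/243 * s ^ 10 + 1/729 * s ^ 11) + r * (4860 + 14580 * s + 18684 * s ^ 2 +
          13446 * s ^ 3 + 6057 * s ^ 4 + 1846 * s ^ 5 + 1259/3 * s ^ 6 + 77 * s ^ 7 +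
          281/27 * s ^ 8 + 8/9 * s ^ 9 + 17/243 * s ^ 10 + 1/243 * s ^ 11)) := by
      rw [hA, hT, hw, hq, hs']
      ring
    rw [this]; positivity

/-- The analogue of `boundary_ineq_one` for `d = 2`, where the slope is `g = 0` and the common factor
`v * (b + 1) / (1 + v)` cancels. -/
lemma boundary_ineq_two {r s b u v e : ℝ} (hr : 0 < r) (hs : 0 < s) (hs' : s = 2 * r ^ 2 - 2)
    (hb : b = 2 * (1 + r ^ 2) / s) (hv : v = s * (1 + r) / (2 * (1 + r ^ 2)))
    (hu : u = s * (1 + r + s ^ 2 / 16) / 4) (he : (1 + e) * (1 + v) = 1 + u) :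
    1 + v ≤ 1 + b * e + b * (b - 1) / 2 * e ^ 2 := by
  obtain ⟨q, hq⟩ : ∃ q, q = 1 + r ^ 2 := ⟨_, rfl⟩
  obtain ⟨w, hw⟩ : ∃ w, w = 1 + r := ⟨_, rfl⟩
  obtain ⟨T, hT⟩ : ∃ T, T = 2 * q + s * w := ⟨_, rfl⟩
  obtain ⟨A, hA⟩ : ∃ A, A = w + s * q / 8 := ⟨_, rfl⟩
  have hq0 : 0 < q := by rw [hq]; positivity
  have hw0 : 0 < w := by rw [hw]; positivity
  have hT0 : 0 < T := by rw [hT]; positivity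
  have hA0 : 0 < A := by rw [hA]; positivity
  rw [← hq] at hb hv
  rw [← hw] at hv hu
  have hqs : q = (s + 4) / 2 := by rw [hq, hs']; ring
  have h1v : 1 + v = T / (2 * q) := by rw [hv, hT]; field_simp
  have he' : e = s ^ 2 * A / (4 * T) := by
    have : e = (1 + u) / (1 + v) - 1 := by
      rw [← he, mul_div_cancel_right₀]; · ring
      rw [h1v]; positivity
    rw [this, h1v, hu, hT, hA, hqs]; field_simp; ring
  have hbe : b * (b - 1) = 2 * q * 4 / s ^ 2 := by rw [hb, hqs]; field_simp; ring
  rw [hbe, h1v, he', hb, ← sub_nonneg]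
  have key : 1 + 2 * q / s * (s ^ 2 * A / (4 * T)) +
      2 * q * 4 / s ^ 2 / 2 * (s ^ 2 * A / (4 * T)) ^ 2 - T / (2 * q) =
      (2 * q * (8 * T ^ 2 + 4 * q * s * A * T + 2 * q * s ^ 2 * A ^ 2) - 8 * T ^ 3) /
        (16 * q * T ^ 2) := by
    field_simp
    ring
  rw [key]
  refine div_nonneg ?_ (by positivity)
  have : 2 * q * (8 * T ^ 2 + 4 * q * s * A * T + 2 * q * s ^ 2 * A ^ 2) - 8 * T ^ 3 =
      s ^ 2 * ((32 + 40 * s + 25 * s ^ 2 + 15/2 * s ^ 3 + 3/4 * s ^ 4 + 1/16 * s ^ 5 +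
        1/256 * s ^ 6) + r * (16 * s + 16 * s ^ 2 + 3 * s ^ 3 + 1/4 * s ^ 4)) := by
    rw [hA, hT, hw, hq, hs']
    ring
  rw [this]; positivity

/-- The analogue of `boundary_ineq_one` for `d = 3`, where the slope is `g = 0` and the common factor
`v * (b + 1) / (1 + v)` cancels. -/
lemma boundary_ineq_three {r s b u v e : ℝ} (hr : 0 < r) (hs : 0 < s) (hs' : s = 3 * r ^ 2 - 2)
    (hb : b = 3 * (1 + r ^ 2) / s) (hv : v = s * (1 + r) / (2 * (1 + r ^ 2)))
    (hu : u = 3 * s * (1 + r + s ^ 2 / 25) / 10) (he : (1 + e) * (1 + v) = 1 + u) :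
    1 + v ≤ 1 + b * e + b * (b - 1) / 2 * e ^ 2 := by
  obtain ⟨q, hq⟩ : ∃ q, q = 1 + r ^ 2 := ⟨_, rfl⟩
  obtain ⟨w, hw⟩ : ∃ w, w = 1 + r := ⟨_, rfl⟩
  obtain ⟨T, hT⟩ : ∃ T, T = 2 * q + s * w := ⟨_, rfl⟩
  obtain ⟨A, hA⟩ : ∃ A, A = w + 3 * s * q / 25 := ⟨_, rfl⟩
  have hq0 : 0 < q := by rw [hq]; positivity
  have hw0 : 0 < w := by rw [hw]; positivity
  have hT0 : 0 < T := by rw [hT]; positivity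
  have hA0 : 0 < A := by rw [hA]; positivity
  rw [← hq] at hb hv
  rw [← hw] at hv hu
  have hqs : q = (s + 5) / 3 := by rw [hq, hs']; ring
  have h1v : 1 + v = T / (2 * q) := by rw [hv, hT]; field_simp
  have he' : e = s ^ 2 * A / (5 * T) := by
    have : e = (1 + u) / (1 + v) - 1 := by
      rw [← he, mul_div_cancel_right₀]; · ring
      rw [h1v]; positivity
    rw [this, h1v, hu, hT, hA, hqs]; field_simp; ring
  have hbe : b * (b - 1) = 3 * q * 5 / s ^ 2 := by rw [hb, hqs]; field_simp; ring
  rw [hbe, h1v, he', hb, ← sub_nonneg]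
  have key : 1 + 3 * q / s * (s ^ 2 * A / (5 * T)) +
      3 * q * 5 / s ^ 2 / 2 * (s ^ 2 * A / (5 * T)) ^ 2 - T / (2 * q) =
      (2 * q * (10 * T ^ 2 + 6 * q * s * A * T + 3 * q * s ^ 2 * A ^ 2) - 10 * T ^ 3) /
        (20 * q * T ^ 2) := by
    field_simp
    ring
  rw [key]
  refine div_nonneg ?_ (by positivity)
  have : 2 * q * (10 * T ^ 2 + 6 * q * s * A * T + 3 * q * s ^ 2 * A ^ 2) - 10 * T ^ 3 =
      s ^ 2 * ((50/3 + 140/9 * s + 94/9 * s ^ 2 + 158/45 * s ^ 3 + 68/225 * s ^ 4 +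
        8/375 * s ^ 5 + 2/1875 * s ^ 6) + r * (-100/9 + -10/9 * s + 86/9 * s ^ 2 +
        8/5 * s ^ 3 + 8/75 * s ^ 4)) := by
    rw [hA, hT, hw, hq, hs']
    ring
  rw [this]
  -- The two negative coefficients are absorbed using `2 * r ≤ 1 + r ^ 2 = (s + 5) / 3`.
  have hrs : 0 ≤ (s + 5) / 6 - r := by nlinarith [sq_nonneg (r - 1)]
  have hsplit : (50/3 + 140/9 * s + 94/9 * s ^ 2 + 158/45 * s ^ 3 + 68/225 * s ^ 4 +
        8/375 * s ^ 5 + 2/1875 * s ^ 6) + r * (-100/9 + -10/9 * s + 86/9 * s ^ 2 +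
        8/5 * s ^ 3 + 8/75 * s ^ 4) = ((s + 5) / 6 - r) * (100/9 + 10/9 * s) +
      (200/27 + 345/27 * s + 277/27 * s ^ 2 + 158/45 * s ^ 3 + 68/225 * s ^ 4 +
        8/375 * s ^ 5 + 2/1875 * s ^ 6) + r * (86/9 * s ^ 2 + 8/5 * s ^ 3 + 8/75 * s ^ 4) := by
    ring
  rw [hsplit]; positivity

/-- The analogue of `boundary_ineq_one` for `d = 4`, with slope `g = 1`. -/
lemma boundary_ineq_four {r s b u v e : ℝ} (hr : 0 < r) (hs : 0 < s) (hs' : s = 4 * r ^ 2 - 2)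
    (hb : b = 4 * (1 + r ^ 2) / s) (hv : v = s * (1 + r) / (2 * (1 + r ^ 2)))
    (hu : u = s * (1 + r + s ^ 2 / 36) / 3) (he : (1 + e) * (1 + v) = 1 + u) :
    v * (b + 1) + 1 * (b + 1 - b / (1 + e)) ≤
      (1 + b * e + b * (b - 1) / 2 * e ^ 2) * (v * (b + 1) / (1 + v) + 1) := by
  obtain ⟨q, hq⟩ : ∃ q, q = 1 + r ^ 2 := ⟨_, rfl⟩
  obtain ⟨w, hw⟩ : ∃ w, w = 1 + r := ⟨_, rfl⟩
  obtain ⟨T, hT⟩ : ∃ T, T = 2 * q + s * w := ⟨_, rfl⟩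
  obtain ⟨A, hA⟩ : ∃ A, A = w + s * q / 9 := ⟨_, rfl⟩
  have hq0 : 0 < q := by rw [hq]; positivity
  have hw0 : 0 < w := by rw [hw]; positivity
  have hT0 : 0 < T := by rw [hT]; positivity
  have hA0 : 0 < A := by rw [hA]; positivity
  rw [← hq] at hb hv
  rw [← hw] at hv hu
  have hqs : q = (s + 6) / 4 := by rw [hq, hs']; ring
  have h1v : 1 + v = T / (2 * q) := by rw [hv, hT]; field_simp
  have he' : e = s ^ 2 * A / (6 * T) := by
    have : e = (1 + u) / (1 + v) - 1 := by
      rw [← he, mul_div_cancel_right₀]; · ring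
      rw [h1v]; positivity
    rw [this, h1v, hu, hT, hA, hqs]; field_simp; ring
  have he0 : 0 < e := by rw [he']; positivity
  have hb0 : 0 < b := by rw [hb]; positivity
  have hvb : v * (b + 1) = w * (4 * q + s) / (2 * q) := by rw [hv, hb]; field_simp
  have hvb' : v * (b + 1) / (1 + v) = w * (4 * q + s) / T := by rw [hvb, h1v]; field_simp
  have hbe : b * (b - 1) = 4 * q * 6 / s ^ 2 := by rw [hb, hqs]; field_simp; ring
  have hdrop : b + 1 - b / (1 + e) ≤ 1 + b * e := by
    have : b + 1 - b / (1 + e) = 1 + b * e - b * e ^ 2 / (1 + e) := by field_simp; ring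
    rw [this]
    have : 0 < b * e ^ 2 / (1 + e) := by positivity
    linarith
  refine (add_le_add_right (mul_le_mul_of_nonneg_left hdrop zero_le_one) _).trans ?_
  rw [hvb', hvb, hbe, he', hb, ← sub_nonneg]
  have key : (1 + 4 * q / s * (s ^ 2 * A / (6 * T)) +
        4 * q * 6 / s ^ 2 / 2 * (s ^ 2 * A / (6 * T)) ^ 2) * (w * (4 * q + s) / T + 1) -
      (w * (4 * q + s) / (2 * q) + 1 * (1 + 4 * q / s * (s ^ 2 * A / (6 * T)))) =
      ((12 * T ^ 2 + 8 * q * s * A * T + 4 * q * s ^ 2 * A ^ 2) * (w * (4 * q + s) + T) * q -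
        6 * T ^ 3 * w * (4 * q + s) - 2 * q * T ^ 2 * (6 * T + 4 * q * s * A)) /
        (12 * q * T ^ 3) := by
    field_simp
    ring
  rw [key]
  refine div_nonneg ?_ (by positivity)
  have : (12 * T ^ 2 + 8 * q * s * A * T + 4 * q * s ^ 2 * A ^ 2) * (w * (4 * q + s) + T) * q -
        6 * T ^ 3 * w * (4 * q + s) - 2 * q * T ^ 2 * (6 * T + 4 * q * s * A) =
      s ^ 2 * ((81/2 + 81/2 * s + 165/4 * s ^ 2 + 53/2 * s ^ 3 + 223/32 * s ^ 4 + 2/3 * s ^ 5 +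
        61/1728 * s ^ 6 + 7/10368 * s ^ 7) + r * (27 + 36 * s + 111/2 * s ^ 2 + 27 * s ^ 3 +
        73/16 * s ^ 4 + 5/16 * s ^ 5 + 13/864 * s ^ 6 + 1/1728 * s ^ 7)) := by
    rw [hA, hT, hw, hq, hs']
    ring
  rw [this]; positivity

/-! ### Comparison of `n` and `n + 2` degrees of freedom -/

/-- The coefficient of variation (standard deviation over mean) of the `F`-distribution with
`d` and `n` degrees of freedom. -/
noncomputable def fCoeffVar (d n : ℝ) : ℝ := √(2 * (n + d - 2) / (d * (n - 4)))

/-- The point one standard deviation above the mean, in the coordinate `y = (d / n) * x` in which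
the `F`-distribution becomes a beta prime distribution. -/
noncomputable def fUpper (d n : ℝ) : ℝ := d * (1 + fCoeffVar d n) / (n - 2)

/-- The point one standard deviation below the mean, in the coordinate `y = (d / n) * x`. -/
noncomputable def fLower (d n : ℝ) : ℝ := d * (1 - fCoeffVar d n) / (n - 2)

/-- Parametrisation by the coefficient of variation `r` at `n + 2` degrees of freedom and by
`s = d * r ^ 2 - 2`: all quantities at `n + 2` become rational in `r`, and the coefficient of
variation at `n` has explicit lower bounds. -/
lemma exists_fCoeffVar_param {d n : ℝ} (hd : 0 < d) (hn : 5 ≤ n) :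
    ∃ r s : ℝ, 0 < r ∧ 0 < s ∧ s = d * r ^ 2 - 2 ∧ 3 * s ≤ 2 * (d + 2) ∧
      n / 2 = d * (1 + r ^ 2) / s ∧ n - 2 = 2 * (d + 2) / s ∧ fCoeffVar d (n + 2) = r ∧
      fUpper d (n + 2) = s * (1 + r) / (2 * (1 + r ^ 2)) ∧
      fLower d (n + 2) = s * (1 - r) / (2 * (1 + r ^ 2)) ∧
      ∀ c : ℝ, 0 ≤ c → (2 * r * c + c ^ 2 * s ^ 2) * (d * (d + 2 - s)) ≤ 1 →
        r + c * s ^ 2 ≤ fCoeffVar d n := by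
  have h2 : 0 < n - 2 := by linarith
  have h4 : 0 < n - 4 := by linarith
  have hr2 : fCoeffVar d (n + 2) ^ 2 = 2 * (n + d) / (d * (n - 2)) := by
    rw [fCoeffVar, Real.sq_sqrt]
    · congr 1 <;> ring
    · rw [show n + 2 + d - 2 = n + d by ring, show n + 2 - 4 = n - 2 by ring]; positivity
  have hr : 0 < fCoeffVar d (n + 2) := by
    rw [fCoeffVar, show n + 2 + d - 2 = n + d by ring, show n + 2 - 4 = n - 2 by ring]
    positivity
  obtain ⟨r, hrdef⟩ : ∃ r, r = fCoeffVar d (n + 2) := ⟨_, rfl⟩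
  rw [← hrdef] at hr hr2
  have hs : d * r ^ 2 - 2 = 2 * (d + 2) / (n - 2) := by rw [hr2]; field_simp; ring
  obtain ⟨s, hsdef⟩ : ∃ s, s = d * r ^ 2 - 2 := ⟨_, rfl⟩
  rw [← hsdef] at hs
  have hs0 : 0 < s := by rw [hs]; positivity
  have hn2 : n - 2 = 2 * (d + 2) / s := by rw [hs]; field_simp
  have hq : d * (1 + r ^ 2) = d + 2 + s := by rw [hsdef]; ring
  have hq0 : 0 < 1 + r ^ 2 := by positivity
  have hn' : n = 2 * (d * (1 + r ^ 2)) / s := by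
    have : n = (n - 2) + 2 := by ring
    rw [this, hn2, hq]; field_simp
  have hs3 : 3 * s ≤ 2 * (d + 2) := by
    rw [hs, ← mul_div_assoc, div_le_iff₀ h2]; nlinarith
  refine ⟨r, s, hr, hs0, hsdef, hs3, ?_, hn2, hrdef.symm, ?_, ?_, ?_⟩
  · rw [hn']; field_simp
  · rw [fUpper, ← hrdef, show n + 2 - 2 = n by ring, hn']; field_simp
  · rw [fLower, ← hrdef, show n + 2 - 2 = n by ring, hn']; field_simp
  · intro c hc h
    rw [fCoeffVar]
    apply Real.le_sqrt_of_sq_le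
    have hds : 0 < d + 2 - s := by linarith
    have hn4 : n - 4 = 2 * (d + 2 - s) / s := by
      rw [show n - 4 = (n - 2) - 2 by ring, hn2]; field_simp
    have h5 : 2 * (n + d - 2) / (d * (n - 4)) = r ^ 2 + s ^ 2 / (d * (d + 2 - s)) := by
      have : r ^ 2 = (s + 2) / d := by rw [hsdef]; field_simp; ring
      rw [hn4, this, show n + d - 2 = (n - 2) + d by ring, hn2]; field_simp; ring
    rw [h5]
    have h6 : 2 * r * c + c ^ 2 * s ^ 2 ≤ 1 / (d * (d + 2 - s)) := by
      rw [le_div_iff₀ (by positivity)]; exact h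
    have h7 := mul_le_mul_of_nonneg_left h6 (sq_nonneg s)
    rw [mul_one_div] at h7
    nlinarith

/-- The upper half of the comparison of `n` and `n + 2` degrees of freedom follows from an
inequality at `v = fUpper d (n + 2)` and a rational lower bound `u` of `fUpper d n`. -/
lemma betaPrimeCDF_fUpper_le_of_le {d n r s c g : ℝ} (hd : 0 < d) (hn : 5 ≤ n) (hr : 0 < r)
    (hs : 0 < s) (hs' : s = d * r ^ 2 - 2) (hn2 : n - 2 = 2 * (d + 2) / s)
    (hv : fUpper d (n + 2) = s * (1 + r) / (2 * (1 + r ^ 2))) (hc : 0 ≤ c)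
    (hρ : r + c * s ^ 2 ≤ fCoeffVar d n)
    (hg : ∀ τ : ℝ, 1 ≤ τ → 1 + g * (τ - 1) ≤ τ ^ (d / 2 - 1))
    (hkey : ∀ v u e : ℝ, 0 < v → v = s * (1 + r) / (2 * (1 + r ^ 2)) →
      u = d * s * (1 + r + c * s ^ 2) / (2 * (d + 2)) → (1 + e) * (1 + v) = 1 + u →
      0 ≤ v * (n / 2 + 1) / (1 + v) + g ∧ v * (n / 2 + 1) + g * (n / 2 + 1 - n / 2 / (1 + e)) ≤
      (1 + n / 2 * e + n / 2 * (n / 2 - 1) / 2 * e ^ 2) * (v * (n / 2 + 1) / (1 + v) + g)) :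
    betaPrimeCDF (d / 2) ((n + 2) / 2) (fUpper d (n + 2)) ≤
      betaPrimeCDF (d / 2) (n / 2) (fUpper d n) := by
  obtain ⟨u, hu⟩ : ∃ u, u = d * s * (1 + r + c * s ^ 2) / (2 * (d + 2)) := ⟨_, rfl⟩
  obtain ⟨v, hvv⟩ : ∃ v, v = s * (1 + r) / (2 * (1 + r ^ 2)) := ⟨_, rfl⟩
  have hv0 : 0 < v := by rw [hvv]; positivity
  have huU : u ≤ fUpper d n := by
    rw [fUpper, hn2, hu]
    rw [div_le_div_iff₀ (by positivity) (by positivity)]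
    have : d * s * (1 + r + c * s ^ 2) * (2 * (d + 2) / s) =
        d * (1 + (r + c * s ^ 2)) * (2 * (d + 2)) := by field_simp; ring
    rw [this]
    gcongr
  have hvu : v ≤ u := by
    rw [hvv, hu, div_le_div_iff₀ (by positivity) (by positivity)]
    have h1 : d * (1 + r ^ 2) = d + 2 + s := by rw [hs']; ring
    have h2 : d * s * (1 + r + c * s ^ 2) * (2 * (1 + r ^ 2)) =
        2 * s * (1 + r + c * s ^ 2) * (d * (1 + r ^ 2)) := by ring
    rw [h2, h1]
    have h3 : 2 * s * (1 + r + c * s ^ 2) * (d + 2 + s) - s * (1 + r) * (2 * (d + 2)) =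
        2 * s * ((1 + r) * s + c * s ^ 2 * (d + 2 + s)) := by ring
    have h4 : 0 ≤ 2 * s * ((1 + r) * s + c * s ^ 2 * (d + 2 + s)) := by positivity
    linarith
  have he : (1 + ((1 + u) / (1 + v) - 1)) * (1 + v) = 1 + u := by field_simp; ring
  obtain ⟨k1, k2⟩ := hkey v u _ hv0 hvv hu he
  rw [hv, ← hvv, show (n + 2) / 2 = n / 2 + 1 by ring]
  refine (betaPrimeCDF_add_one_le (by positivity) (by linarith) (hv0.le.trans hvu) hv0.le ?_).trans
    (betaPrimeCDF_mono (by positivity) (by linarith) (hv0.le.trans hvu) huU)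
  exact betaPrimeBoundary_le_mul_integral (by positivity) (by linarith) hv0 hvu hg he k1 k2

lemma one_sub_half_mul_le_rpow {τ : ℝ} (hτ : 1 ≤ τ) :
    1 + (-1 / 2) * (τ - 1) ≤ τ ^ ((1 : ℝ) / 2 - 1) := by
  have h0 : 0 ≤ τ := by linarith
  have h1 : 1 ≤ √τ := Real.one_le_sqrt.2 hτ
  rw [show (1 : ℝ) / 2 - 1 = -(1 / 2) by norm_num, Real.rpow_neg h0, ← Real.sqrt_eq_rpow,
    ← one_div, le_div_iff₀ (by linarith)]
  obtain ⟨t, ht⟩ : ∃ t, t = √τ := ⟨_, rfl⟩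
  have h2 : τ = t ^ 2 := by rw [ht, Real.sq_sqrt h0]
  rw [← ht] at h1 ⊢
  rw [h2]
  nlinarith [mul_nonneg (sq_nonneg (t - 1)) (by linarith : 0 ≤ t + 2)]

/-- Passing from `n` to `n + 2` degrees of freedom does not increase the probability of lying at
most one standard deviation above the mean. -/
lemma betaPrimeCDF_fUpper_le {d : ℕ} (hd : d ∈ ({1, 2, 3, 4} : Set ℕ)) {n : ℝ} (hn : 5 ≤ n) :
    betaPrimeCDF (d / 2) ((n + 2) / 2) (fUpper d (n + 2)) ≤
      betaPrimeCDF (d / 2) (n / 2) (fUpper d n) := by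
  have hd0 : (0 : ℝ) < d := by
    rcases hd with rfl | rfl | rfl | rfl <;> norm_num
  obtain ⟨r, s, hr, hs, hs', hs3, hb, hn2, -, hv, -, hρ⟩ := exists_fCoeffVar_param hd0 hn
  -- The conclusion of `hkey` in `betaPrimeCDF_fUpper_le_of_le` for the slope `g = 0`.
  have hzero : ∀ v e : ℝ, 0 < v → 1 + v ≤ 1 + n / 2 * e + n / 2 * (n / 2 - 1) / 2 * e ^ 2 →
      0 ≤ v * (n / 2 + 1) / (1 + v) + 0 ∧ v * (n / 2 + 1) + 0 * (n / 2 + 1 - n / 2 / (1 + e)) ≤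
      (1 + n / 2 * e + n / 2 * (n / 2 - 1) / 2 * e ^ 2) * (v * (n / 2 + 1) / (1 + v) + 0) := by
    intro v e hv0 h
    have h1 : 0 ≤ v * (n / 2 + 1) / (1 + v) := by positivity
    have h2 := mul_le_mul_of_nonneg_right h h1
    have h3 : (1 + v) * (v * (n / 2 + 1) / (1 + v)) = v * (n / 2 + 1) := by field_simp
    rw [h3] at h2
    simpa using ⟨h1, h2⟩
  -- The slope `g` and the constant `c` in `r + c * s ^ 2 ≤ fCoeffVar d n` depend on `d`. In each
  -- case `r` is bounded by a tangent of the square root close to `√(2 / d)`, its value at `s = 0`.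
  rcases hd with rfl | rfl | rfl | rfl
  · push_cast at *
    have hrs : 70 * r ≤ 25 * s + 99 := by nlinarith [sq_nonneg (5 * r - 7)]
    refine betaPrimeCDF_fUpper_le_of_le (c := 1 / 9) (g := -1 / 2) hd0 hn hr hs hs' hn2 hv
      (by norm_num) (hρ _ (by norm_num) ?_) (fun τ hτ => one_sub_half_mul_le_rpow hτ) ?_
    · have h1 := mul_le_mul_of_nonneg_right hrs (by linarith : 0 ≤ 3 - s)
      nlinarith [pow_pos hs 2, pow_pos hs 3]
    · intro v u e _ hv hu he
      exact boundary_ineq_one hr hs (by linarith) (by rw [hb]; ring) hv (by rw [hu]; ring) he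
  · push_cast at *
    have hrs : 4 * r ≤ s + 4 := by nlinarith [sq_nonneg (r - 1)]
    refine betaPrimeCDF_fUpper_le_of_le (c := 1 / 16) (g := 0) hd0 hn hr hs hs' hn2 hv
      (by norm_num) (hρ _ (by norm_num) ?_) (fun τ hτ => by norm_num) ?_
    · have h1 := mul_le_mul_of_nonneg_right hrs (by linarith : 0 ≤ 4 - s)
      nlinarith [pow_pos hs 2, pow_pos hs 3]
    · intro v u e hv0 hv hu he
      exact hzero v e hv0
        (boundary_ineq_two hr hs (by linarith) (by rw [hb]) hv (by rw [hu]; ring) he)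
  · push_cast at *
    have hrs : 120 * r ≤ 25 * s + 98 := by nlinarith [sq_nonneg (5 * r - 4)]
    refine betaPrimeCDF_fUpper_le_of_le (c := 1 / 25) (g := 0) hd0 hn hr hs hs' hn2 hv
      (by norm_num) (hρ _ (by norm_num) ?_) (fun τ hτ => ?_) ?_
    · have h1 := mul_le_mul_of_nonneg_right hrs (by linarith : 0 ≤ 5 - s)
      nlinarith [pow_pos hs 2, pow_pos hs 3]
    · rw [zero_mul, add_zero]
      exact Real.one_le_rpow hτ (by norm_num)
    · intro v u e hv0 hv hu he
      exact hzero v e hv0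
        (boundary_ineq_three hr hs (by linarith) (by rw [hb]) hv (by rw [hu]; ring) he)
  · push_cast at *
    have hrs : 140 * r ≤ 25 * s + 99 := by nlinarith [sq_nonneg (10 * r - 7)]
    refine betaPrimeCDF_fUpper_le_of_le (c := 1 / 36) (g := 1) hd0 hn hr hs hs' hn2 hv
      (by norm_num) (hρ _ (by norm_num) ?_) (fun τ hτ => ?_) ?_
    · have h1 := mul_le_mul_of_nonneg_right hrs (by linarith : 0 ≤ 6 - s)
      nlinarith [pow_pos hs 2, pow_pos hs 3]
    · norm_num
    · intro v u e hv0 hv hu he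
      refine ⟨by positivity, ?_⟩
      exact boundary_ineq_four hr hs (by linarith) (by rw [hb]) hv (by rw [hu]; ring) he

/-- If the lower endpoint at `n` is positive, then passing from `n` to `n + 2` degrees of freedom
does not decrease the probability below it. -/
lemma betaPrimeCDF_fLower_le_of_pos {d n r s c : ℝ} (hd2 : 2 ≤ d) (hd4 : d ≤ 4) (hn : 5 ≤ n)
    (hs : 0 < s) (hs' : s = d * r ^ 2 - 2) (hb : n / 2 = d * (1 + r ^ 2) / s)
    (hn2 : n - 2 = 2 * (d + 2) / s)
    (hv : fLower d (n + 2) = s * (1 - r) / (2 * (1 + r ^ 2))) (hc : 0 < c)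
    (hρ : r + c * s ^ 2 ≤ fCoeffVar d n) (hpos : 0 < fLower d n)
    (hkey : (2 * (d + 2) + s) * (1 - r) ≤ (d + 2) ^ 3 * c) :
    betaPrimeCDF (d / 2) (n / 2) (fLower d n) ≤
      betaPrimeCDF (d / 2) ((n + 2) / 2) (fLower d (n + 2)) := by
  obtain ⟨u, hu⟩ : ∃ u, u = d * s * (1 - r - c * s ^ 2) / (2 * (d + 2)) := ⟨_, rfl⟩
  obtain ⟨v, hvv⟩ : ∃ v, v = s * (1 - r) / (2 * (1 + r ^ 2)) := ⟨_, rfl⟩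
  have hd0 : 0 < d := by linarith
  have huU : fLower d n ≤ u := by
    rw [fLower, hn2, hu]
    rw [div_le_div_iff₀ (by positivity) (by positivity)]
    have : d * s * (1 - r - c * s ^ 2) * (2 * (d + 2) / s) =
        d * (1 - (r + c * s ^ 2)) * (2 * (d + 2)) := by field_simp; ring
    rw [this]
    gcongr
  have hu0 : 0 < u := hpos.trans_le huU
  have hf : 0 < 1 - r - c * s ^ 2 := by
    rw [hu] at hu0
    have h1 := (div_pos_iff_of_pos_right (by positivity : 0 < 2 * (d + 2))).1 hu0
    exact pos_of_mul_pos_right h1 (by positivity)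
  have hcs : 0 < c * s ^ 2 := by positivity
  have hf' : 0 < 1 - r := by linarith
  have hv0 : 0 < v := by rw [hvv]; positivity
  rw [hv, ← hvv, show (n + 2) / 2 = n / 2 + 1 by ring]
  refine (betaPrimeCDF_mono (by positivity) (by linarith) hpos.le huU).trans ?_
  have hq : d * (1 + r ^ 2) = d + 2 + s := by rw [hs']; ring
  rcases le_total u v with huv | hvu
  · refine le_betaPrimeCDF_add_one (by positivity) (by linarith) hu0.le hv0.le ?_
    rw [intervalIntegral.integral_symm, mul_neg]
    have : 0 ≤ ∫ t in u..v, betaPrimeKernel (d / 2) (n / 2) t :=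
      intervalIntegral.integral_nonneg huv fun t ht =>
        (betaPrimeKernel_pos (hu0.trans_le ht.1)).le
    have h2 : 0 ≤ n / 2 * ∫ t in u..v, betaPrimeKernel (d / 2) (n / 2) t :=
      mul_nonneg (by linarith) this
    have := betaPrimeBoundary_nonneg (a := d / 2) (b := n / 2) hv0.le
    linarith
  · refine le_betaPrimeCDF_add_one (by positivity) (by linarith) hu0.le hv0.le
      (mul_integral_le_betaPrimeBoundary (by linarith) (by linarith) (by linarith) hv0 hvu ?_)
    have hq0 : 0 < d + 2 + s := by positivity
    have hv' : v = d * s * (1 - r) / (2 * (d + 2 + s)) := by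
      rw [hvv, ← hq]; field_simp
    rw [hb, hq, hv', hu, ← sub_nonneg]
    have e1 : (d * s * (1 - r) / (2 * (d + 2 + s))) ^ 2 -
        (d + 2 + s) / s * (d * s * (1 - r - c * s ^ 2) / (2 * (d + 2)) -
          d * s * (1 - r) / (2 * (d + 2 + s))) * (d * s * (1 - r - c * s ^ 2) / (2 * (d + 2))) =
        d ^ 2 * s ^ 2 * ((d + 2) ^ 2 * (1 - r) ^ 2 - (d + 2 + s) ^ 2 *
          ((1 - r) - (d + 2 + s) * c * s) * (1 - r - c * s ^ 2)) /
          (4 * (d + 2) ^ 2 * (d + 2 + s) ^ 2) := by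
      field_simp
      ring
    rw [e1]
    refine div_nonneg (mul_nonneg (by positivity) ?_) (by positivity)
    have h1 : (d + 2 + s) ^ 2 * ((1 - r) - (d + 2 + s) * c * s) ≤ (d + 2) ^ 2 * (1 - r) := by
      have h2 : (d + 2) ^ 3 * c ≤ (d + 2 + s) ^ 3 * c :=
        mul_le_mul_of_nonneg_right (pow_le_pow_left₀ (by linarith) (by linarith) 3) hc.le
      have h3 := mul_le_mul_of_nonneg_left (hkey.trans h2) hs.le
      nlinarith
    have h4 := mul_le_mul_of_nonneg_right h1 hf.le
    have h5 : (d + 2) ^ 2 * (1 - r) * (1 - r - c * s ^ 2) ≤ (d + 2) ^ 2 * (1 - r) * (1 - r) :=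
      mul_le_mul_of_nonneg_left (by linarith) (by positivity)
    nlinarith

lemma betaPrimeCDF_fLower_le {d : ℕ} (hd : d ∈ ({1, 2, 3, 4} : Set ℕ)) {n : ℝ} (hn : 5 ≤ n) :
    betaPrimeCDF (d / 2) (n / 2) (max (fLower d n) 0) ≤
      betaPrimeCDF (d / 2) ((n + 2) / 2) (max (fLower d (n + 2)) 0) := by
  have hd0 : (0 : ℝ) < d := by
    rcases hd with rfl | rfl | rfl | rfl <;> norm_num
  rcases le_or_gt (fLower d n) 0 with h0 | h0
  · rw [max_eq_right h0, betaPrimeCDF_zero]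
    exact betaPrimeCDF_nonneg (by positivity) (by linarith) (le_max_right _ _)
  rw [max_eq_left h0.le]
  obtain ⟨r, s, hr, hs, hs', hs3, hb, hn2, -, -, hv, hρ⟩ := exists_fCoeffVar_param hd0 hn
  have hr1 : r < 1 := by
    have h1 := hρ 0 le_rfl (by norm_num)
    rw [fLower] at h0
    have h2 := (div_pos_iff_of_pos_right (by linarith : 0 < n - 2)).1 h0
    have h3 := pos_of_mul_pos_right h2 hd0.le
    linarith
  refine le_trans ?_ (betaPrimeCDF_mono (by positivity) (by linarith) ?_ (le_max_left _ _))
  swap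
  · rw [hv]; exact div_nonneg (mul_nonneg hs.le (by linarith)) (by positivity)
  rcases hd with rfl | rfl | rfl | rfl
  · push_cast at *
    nlinarith
  · push_cast at *
    nlinarith
  · push_cast at *
    have hrs : 120 * r ≤ 25 * s + 98 := by nlinarith [sq_nonneg (5 * r - 4)]
    have hr' : 4 / 5 < r := by nlinarith
    refine betaPrimeCDF_fLower_le_of_pos (c := 1 / 25) (by norm_num) (by norm_num) hn hs hs' hb hn2
      hv (by norm_num) (hρ _ (by norm_num) ?_) h0 ?_
    · have h1 := mul_le_mul_of_nonneg_right hrs (by linarith : 0 ≤ 5 - s)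
      nlinarith [pow_pos hs 2, pow_pos hs 3]
    · nlinarith
  · push_cast at *
    have hrs : 140 * r ≤ 25 * s + 99 := by nlinarith [sq_nonneg (10 * r - 7)]
    have hr' : 7 / 10 < r := by nlinarith
    refine betaPrimeCDF_fLower_le_of_pos (c := 1 / 36) (by norm_num) (by norm_num) hn hs hs' hb hn2
      hv (by norm_num) (hρ _ (by norm_num) ?_) h0 ?_
    · have h1 := mul_le_mul_of_nonneg_right hrs (by linarith : 0 ≤ 6 - s)
      nlinarith [pow_pos hs 2, pow_pos hs 3]
    · nlinarith

/-! ### Moments and one standard deviation probabilities -/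

lemma memLp_of_hasLaw {Ω : Type*} [MeasurableSpace Ω] {X : Ω → ℝ} {P : Measure Ω}
    {μ : Measure ℝ} (hX : HasLaw X μ P) (hμ : MemLp id 2 μ) : MemLp X 2 P := by
  rw [← hX.map_eq] at hμ
  exact hμ.comp_of_map hX.aemeasurable

lemma probWithinOneSD_eq_of_hasLaw {Ω : Type*} [MeasurableSpace Ω] {X : Ω → ℝ} {P : Measure Ω}
    {μ : Measure ℝ} (hX : HasLaw X μ P) : probWithinOneSD X P = probWithinOneSD id μ := by
  unfold probWithinOneSD
  rw [hX.integral_eq, hX.variance_eq]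
  exact hX.measureReal_eq (p := fun x => |x - ∫ y, y ∂μ| ≤ √(Var[id; μ]))
    (measurableSet_le (by fun_prop) measurable_const)

/-- `μ` has, up to the scaling `x = c * y` and the normalising constant `K`, the density `h`
on the positive half-line. -/
structure HasScaledDensity (μ : Measure ℝ) (h : ℝ → ℝ) (c K : ℝ) : Prop where
  integral_eq : ∀ φ : ℝ → ℝ, ∫ x, φ x ∂μ = K * ∫ y in Ioi 0, φ (c * y) * h y
  integrable : ∀ φ : ℝ → ℝ, IntegrableOn (fun y => φ (c * y) * h y) (Ioi 0) → Integrable φ μ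

lemma hasScaledDensity_withDensity {f h : ℝ → ℝ} {c K : ℝ} (hf : Measurable f) (hc : 0 < c)
    (hf0 : ∀ x, 0 ≤ f x) (hneg : ∀ x < 0, f x = 0) (hpos : ∀ y, 0 < y → c * f (c * y) = K * h y) :
    HasScaledDensity (volume.withDensity fun x => ENNReal.ofReal (f x)) h c K := by
  have hind : ∀ φ : ℝ → ℝ, (fun x => f x * φ x) =ᵐ[volume]
      (Ioi 0).indicator (fun x => f x * φ x) := by
    intro φ
    filter_upwards [compl_mem_ae_iff.2 (measure_singleton (0 : ℝ))] with x hx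
    rcases lt_trichotomy x 0 with h1 | h1 | h1
    · rw [hneg x h1, zero_mul, indicator_of_notMem]
      exact not_lt.2 h1.le
    · exact absurd h1 hx
    · rw [indicator_of_mem]
      exact h1
  have hchange : ∀ φ : ℝ → ℝ, ∀ y ∈ Ioi (0 : ℝ),
      f (c * y) * φ (c * y) = c⁻¹ * (K * (φ (c * y) * h y)) := by
    intro φ y hy
    have := hpos y hy
    have h1 : f (c * y) = c⁻¹ * (K * h y) := by rw [← this]; field_simp
    rw [h1]; ring
  constructor
  · intro φ
    rw [integral_withDensity_eq_integral_toReal_smul (by fun_prop) (by simp)]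
    simp only [ENNReal.toReal_ofReal (hf0 _), smul_eq_mul]
    rw [integral_congr_ae (hind φ), integral_indicator measurableSet_Ioi,
      ← mul_zero c, ← integral_comp_mul_left_Ioi' _ 0 hc, mul_zero,
      setIntegral_congr_fun measurableSet_Ioi (hchange φ), integral_const_mul,
      integral_const_mul, smul_eq_mul, mul_inv_cancel_left₀ hc.ne']
  · intro φ hφ
    rw [integrable_withDensity_iff_integrable_smul' (by fun_prop) (by simp)]
    simp only [ENNReal.toReal_ofReal (hf0 _), smul_eq_mul]
    rw [integrable_congr (hind φ), integrable_indicator_iff measurableSet_Ioi, ← mul_zero c,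
      ← integrableOn_Ioi_comp_mul_left_iff _ _ hc]
    exact IntegrableOn.congr_fun ((hφ.const_mul K).const_mul c⁻¹)
      (fun y hy => (hchange φ y hy).symm) measurableSet_Ioi

/-- The one standard deviation probability of a law on the positive half-line in terms of its
unnormalised density `h`, whose mean and standard deviation are `m` and `s`. -/
lemma HasScaledDensity.memLp_and_probWithinOneSD {μ : Measure ℝ} [IsProbabilityMeasure μ]
    {h : ℝ → ℝ} {c K m s : ℝ} (H : HasScaledDensity μ h c K) (hc : 0 < c) (hm : 0 ≤ m)
    (hs : 0 ≤ s) (h2 : IntegrableOn (fun y => y ^ 2 * h y) (Ioi 0))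
    (M1 : ∫ y in Ioi 0, y * h y = m * ∫ y in Ioi 0, h y)
    (M2 : ∫ y in Ioi 0, y ^ 2 * h y = (m ^ 2 + s ^ 2) * ∫ y in Ioi 0, h y) :
    MemLp id 2 μ ∧
      probWithinOneSD id μ = (∫ y in (max (m - s) 0)..(m + s), h y) / ∫ y in Ioi 0, h y := by
  have hK : K * ∫ y in Ioi 0, h y = 1 := by
    have := H.integral_eq fun _ => 1
    simpa using this.symm
  have hI : ∫ y in Ioi 0, h y ≠ 0 := by
    intro h; rw [h, mul_zero] at hK; exact zero_ne_one hK
  have hK' : K = 1 / ∫ y in Ioi 0, h y := by field_simp; exact hK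
  have hmem : MemLp id 2 μ := by
    rw [memLp_two_iff_integrable_sq aestronglyMeasurable_id]
    refine H.integrable _ ?_
    refine IntegrableOn.congr_fun (h2.const_mul (c ^ 2)) (fun y _ => ?_) measurableSet_Ioi
    simp only [id]; ring
  refine ⟨hmem, ?_⟩
  have hmean : ∫ x, x ∂μ = c * m := by
    rw [H.integral_eq fun x => x]
    simp_rw [mul_assoc]
    rw [integral_const_mul, M1]
    linear_combination c * m * hK
  have hsq : ∫ x, x ^ 2 ∂μ = c ^ 2 * (m ^ 2 + s ^ 2) := by
    rw [H.integral_eq fun x => x ^ 2]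
    simp_rw [mul_pow, mul_assoc]
    rw [integral_const_mul, M2]
    linear_combination c ^ 2 * (m ^ 2 + s ^ 2) * hK
  have hvar : Var[id; μ] = (c * s) ^ 2 := by
    rw [variance_eq_sub hmem]
    have e1 : μ[id ^ 2] = ∫ x, x ^ 2 ∂μ := rfl
    have e2 : μ[id] = ∫ x, x ∂μ := rfl
    rw [e1, e2, hmean, hsq]; ring
  have hS : MeasurableSet {x : ℝ | |x - c * m| ≤ c * s} :=
    measurableSet_le (by fun_prop) measurable_const
  unfold probWithinOneSD
  simp only [id]
  rw [hvar, Real.sqrt_sq (by positivity), hmean, ← integral_indicator_one hS, H.integral_eq]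
  have e4 : ∀ y ∈ Ioi (0 : ℝ), ({x : ℝ | |x - c * m| ≤ c * s}.indicator 1 (c * y) : ℝ) * h y =
      (Icc (m - s) (m + s)).indicator h y := by
    intro y _
    have : c * y ∈ {x : ℝ | |x - c * m| ≤ c * s} ↔ y ∈ Icc (m - s) (m + s) := by
      rw [mem_ofPred_eq, ← mul_sub, abs_mul, abs_of_pos hc, mul_le_mul_iff_right₀ hc, abs_le,
        mem_Icc]
      constructor <;> rintro ⟨h1, h2⟩ <;> constructor <;> linarith
    by_cases hy : y ∈ Icc (m - s) (m + s)
    · rw [indicator_of_mem hy, indicator_of_mem (this.2 hy), Pi.one_apply, one_mul]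
    · rw [indicator_of_notMem hy, indicator_of_notMem (fun h => hy (this.1 h)), zero_mul]
  rw [setIntegral_congr_fun measurableSet_Ioi e4, setIntegral_indicator measurableSet_Icc,
    intervalIntegral.integral_of_le (max_le (by linarith) (by linarith)), hK', one_div,
    div_eq_inv_mul]
  congr 1
  refine setIntegral_congr_set ?_
  have e5 : Ioc (max (m - s) 0) (m + s) = Ioi 0 ∩ Ioc (m - s) (m + s) := by
    ext y
    simp only [mem_Ioc, max_lt_iff, mem_inter_iff, mem_Ioi]
    tauto
  rw [e5]
  exact (ae_eq_refl _).inter Ioc_ae_eq_Icc.symm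

lemma fPDFReal_nonneg (d n : ℕ) (x : ℝ) : 0 ≤ fPDFReal d n x := by
  unfold fPDFReal
  split_ifs with hx
  · have : 0 ≤ beta ((d : ℝ) / 2) ((n : ℝ) / 2) := by
      unfold beta
      have h1 : 0 ≤ Real.Gamma ((d : ℝ) / 2) := Real.Gamma_nonneg_of_nonneg (by positivity)
      have h2 : 0 ≤ Real.Gamma ((n : ℝ) / 2) := Real.Gamma_nonneg_of_nonneg (by positivity)
      have h3 : 0 ≤ Real.Gamma ((d : ℝ) / 2 + (n : ℝ) / 2) :=
        Real.Gamma_nonneg_of_nonneg (by positivity)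
      positivity
    positivity
  · exact le_rfl

lemma measurable_fPDFReal (d n : ℕ) : Measurable (fPDFReal d n) := by
  unfold fPDFReal
  exact Measurable.ite measurableSet_Ioi (by fun_prop) measurable_const

lemma hasScaledDensity_fMeasure {d n : ℕ} (hd : 0 < d) (hn : 0 < n) :
    HasScaledDensity (fMeasure d n) (betaPrimeKernel (d / 2) (n / 2)) (n / d)
      (1 / beta ((d : ℝ) / 2) ((n : ℝ) / 2)) := by
  have hd0 : (0 : ℝ) < d := by exact_mod_cast hd
  have hn0 : (0 : ℝ) < n := by exact_mod_cast hn
  refine hasScaledDensity_withDensity (measurable_fPDFReal d n) (by positivity)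
    (fPDFReal_nonneg d n) (fun x hx => if_neg (not_lt.2 hx.le)) fun y hy => ?_
  have hc : (0 : ℝ) < n / d * y := by positivity
  rw [fPDFReal, if_pos hc, betaPrimeKernel]
  have h1 : (d : ℝ) / n * (n / d * y) = y := by field_simp
  have h2 : (d : ℝ) / n = (n / d : ℝ)⁻¹ := by field_simp
  have h3 : (n / d * y : ℝ) ^ ((d : ℝ) / 2 - 1) =
      (n / d : ℝ) ^ ((d : ℝ) / 2) / (n / d) * y ^ ((d : ℝ) / 2 - 1) := by
    rw [Real.mul_rpow (by positivity) hy.le, Real.rpow_sub_one (by positivity)]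
  rw [h1, h3, h2, Real.inv_rpow (by positivity), show ((d : ℝ) + n) / 2 = d / 2 + n / 2 by ring]
  have h4 : (n / d : ℝ) ^ ((d : ℝ) / 2) ≠ 0 := by positivity
  field_simp

/-- The one standard deviation probability of the `F`-distribution with `d` and `n` degrees of
freedom, as a beta prime probability; negative `y` carry no mass, whence the `max`. -/
noncomputable def fProb (d n : ℝ) : ℝ :=
  (∫ y in (max (fLower d n) 0)..(fUpper d n), betaPrimeKernel (d / 2) (n / 2) y) /
    betaPrimeMass (d / 2) (n / 2)

lemma memLp_and_probWithinOneSD_fMeasure {d n : ℕ} (hd : 0 < d) (hn : 5 ≤ n)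
    [IsProbabilityMeasure (fMeasure d n)] :
    MemLp id 2 (fMeasure d n) ∧ probWithinOneSD id (fMeasure d n) = fProb d n := by
  have hd0 : (0 : ℝ) < d := by exact_mod_cast hd
  have hn0 : (5 : ℝ) ≤ n := by exact_mod_cast hn
  have ha : (0 : ℝ) < d / 2 := by positivity
  have hb2 : (0 : ℝ) < (n : ℝ) / 2 - 1 - 1 := by linarith
  have hn2 : (0 : ℝ) < n - 2 := by linarith
  have hn4 : (0 : ℝ) < n - 4 := by linarith
  have e1 : ∀ y ∈ Ioi (0 : ℝ), y * betaPrimeKernel (d / 2) (n / 2) y =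
      betaPrimeKernel (d / 2 + 1) (n / 2 - 1) y := fun y hy => mul_betaPrimeKernel hy
  have e2 : ∀ y ∈ Ioi (0 : ℝ), y ^ 2 * betaPrimeKernel (d / 2) (n / 2) y =
      betaPrimeKernel (d / 2 + 1 + 1) (n / 2 - 1 - 1) y := fun y hy => by
    rw [sq, mul_assoc, mul_betaPrimeKernel hy, mul_betaPrimeKernel hy]
  have hρ : fCoeffVar d n ^ 2 = 2 * (n + d - 2) / (d * (n - 4)) := by
    rw [fCoeffVar, Real.sq_sqrt]
    have : (0 : ℝ) < n + d - 2 := by linarith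
    positivity
  have m1 := mul_betaPrimeMass_eq (a := (d : ℝ) / 2) (b := n / 2 - 1) ha (by linarith)
  have m2 := mul_betaPrimeMass_eq (a := (d : ℝ) / 2 + 1) (b := n / 2 - 1 - 1) (by linarith) hb2
  rw [sub_add_cancel] at m1 m2
  have m1' : betaPrimeMass (d / 2 + 1) (n / 2 - 1) =
      d / (n - 2) * betaPrimeMass (d / 2) (n / 2) := by
    rw [div_mul_eq_mul_div, eq_div_iff hn2.ne']; linarith
  have m2' : betaPrimeMass (d / 2 + 1 + 1) (n / 2 - 1 - 1) =
      (d + 2) / (n - 4) * betaPrimeMass (d / 2 + 1) (n / 2 - 1) := by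
    rw [div_mul_eq_mul_div, eq_div_iff hn4.ne']; linarith
  have := (hasScaledDensity_fMeasure hd (by linarith : 0 < n)).memLp_and_probWithinOneSD
    (m := d / (n - 2)) (s := d / (n - 2) * fCoeffVar d n) (by positivity) (by positivity)
    (mul_nonneg (by positivity) (Real.sqrt_nonneg _)) ?_ ?_ ?_
  · rw [show (d : ℝ) / (n - 2) - d / (n - 2) * fCoeffVar d n = fLower d n by
      rw [fLower]; ring, show (d : ℝ) / (n - 2) + d / (n - 2) * fCoeffVar d n = fUpper d n by
      rw [fUpper]; ring] at this
    exact this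
  · exact (integrableOn_betaPrimeKernel (by linarith) hb2).congr_fun (fun y hy => (e2 y hy).symm)
      measurableSet_Ioi
  · rw [setIntegral_congr_fun measurableSet_Ioi e1]
    exact m1'
  · rw [setIntegral_congr_fun measurableSet_Ioi e2, mul_pow, hρ]
    change betaPrimeMass _ _ = _ * betaPrimeMass _ _
    rw [m2', m1']
    field_simp
    ring

/-- The unnormalised density of the `χ²(2 a)` distribution on the positive half-line. -/
noncomputable def chiSquaredKernel (a x : ℝ) : ℝ := x ^ (a - 1) * Real.exp (-(1 / 2 * x))

lemma integral_chiSquaredKernel {a : ℝ} (ha : 0 < a) :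
    ∫ x in Ioi 0, chiSquaredKernel a x = 2 ^ a * Real.Gamma a := by
  unfold chiSquaredKernel
  rw [Real.integral_rpow_mul_exp_neg_mul_Ioi ha (by norm_num)]
  norm_num

lemma integrableOn_chiSquaredKernel {a : ℝ} (ha : 0 < a) :
    IntegrableOn (chiSquaredKernel a) (Ioi 0) := by
  have h := integral_chiSquaredKernel ha
  have h2 : 0 < (2 : ℝ) ^ a * Real.Gamma a := by
    have := Real.Gamma_pos_of_pos ha
    positivity
  exact Integrable.of_integral_ne_zero (by rw [h]; exact h2.ne')

lemma mul_chiSquaredKernel {a x : ℝ} (hx : 0 < x) :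
    x * chiSquaredKernel a x = chiSquaredKernel (a + 1) x := by
  unfold chiSquaredKernel
  have h2 : x ^ (a + 1 - 1) = x ^ (a - 1) * x := by
    rw [← Real.rpow_add_one hx.ne']; congr 1; ring
  rw [h2]; ring

lemma integral_chiSquaredKernel_add_one {a : ℝ} (ha : 0 < a) :
    ∫ x in Ioi 0, chiSquaredKernel (a + 1) x = 2 * a * ∫ x in Ioi 0, chiSquaredKernel a x := by
  rw [integral_chiSquaredKernel ha, integral_chiSquaredKernel (by linarith),
    Real.Gamma_add_one ha.ne', Real.rpow_add_one two_ne_zero]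
  ring

/-- The one standard deviation probability of the `χ²(d)` distribution. -/
noncomputable def chiSquaredProb (d : ℝ) : ℝ :=
  (∫ x in (max (d - √(2 * d)) 0)..(d + √(2 * d)), chiSquaredKernel (d / 2) x) /
    ∫ x in Ioi 0, chiSquaredKernel (d / 2) x

lemma memLp_and_probWithinOneSD_chiSquaredMeasure {d : ℕ} (hd : 0 < d) :
    MemLp id 2 (chiSquaredMeasure d) ∧
      probWithinOneSD id (chiSquaredMeasure d) = chiSquaredProb d := by
  have hd0 : (0 : ℝ) < d := by exact_mod_cast hd
  have ha : (0 : ℝ) < d / 2 := by positivity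
  have : IsProbabilityMeasure (chiSquaredMeasure d) :=
    isProbabilityMeasure_gammaMeasure ha (by norm_num)
  have H : HasScaledDensity (chiSquaredMeasure d) (chiSquaredKernel (d / 2)) 1
      ((1 / 2) ^ ((d : ℝ) / 2) / Real.Gamma (d / 2)) := by
    refine hasScaledDensity_withDensity (measurable_gammaPDFReal _ _) one_pos
      (gammaPDFReal_nonneg ha (by norm_num)) (fun x hx => if_neg (not_le.2 hx)) fun y hy => ?_
    rw [one_mul, one_mul, gammaPDFReal, if_pos hy.le, chiSquaredKernel]
    ring
  have e1 : ∀ y ∈ Ioi (0 : ℝ), y * chiSquaredKernel (d / 2) y =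
      chiSquaredKernel (d / 2 + 1) y := fun y hy => mul_chiSquaredKernel hy
  have e2 : ∀ y ∈ Ioi (0 : ℝ), y ^ 2 * chiSquaredKernel (d / 2) y =
      chiSquaredKernel (d / 2 + 1 + 1) y := fun y hy => by
    rw [sq, mul_assoc, mul_chiSquaredKernel hy, mul_chiSquaredKernel hy]
  refine H.memLp_and_probWithinOneSD one_pos hd0.le (Real.sqrt_nonneg _) ?_ ?_ ?_
  · exact (integrableOn_chiSquaredKernel (by linarith)).congr_fun (fun y hy => (e2 y hy).symm)
      measurableSet_Ioi
  · rw [setIntegral_congr_fun measurableSet_Ioi e1, integral_chiSquaredKernel_add_one ha]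
    ring
  · rw [setIntegral_congr_fun measurableSet_Ioi e2,
      integral_chiSquaredKernel_add_one (by linarith), integral_chiSquaredKernel_add_one ha,
      Real.sq_sqrt (by positivity)]
    ring

/-! ### Convergence to the `χ²` distribution -/

/-- The beta prime kernel with parameters `a` and `n / 2` in the coordinate `t = n * y`, rescaled
so as to converge to the `χ²` kernel. -/
noncomputable def scaledBetaPrimeKernel (a : ℝ) (n : ℕ) (t : ℝ) : ℝ :=
  t ^ (a - 1) * (1 + t / n) ^ (-(a + n / 2))

lemma betaPrimeKernel_inv_mul {a t : ℝ} {n : ℕ} (hn : 0 < n) (ht : 0 < t) :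
    betaPrimeKernel a (n / 2) ((n : ℝ)⁻¹ * t) =
      (n : ℝ) ^ (-(a - 1)) * scaledBetaPrimeKernel a n t := by
  have hn0 : (0 : ℝ) < n := by exact_mod_cast hn
  rw [betaPrimeKernel, scaledBetaPrimeKernel, Real.mul_rpow (by positivity) ht.le,
    Real.inv_rpow hn0.le, Real.rpow_neg hn0.le, div_eq_inv_mul t]
  ring

lemma betaPrimeMass_eq_scaled {a : ℝ} {n : ℕ} (hn : 0 < n) :
    betaPrimeMass a (n / 2) =
      (n : ℝ)⁻¹ * (n : ℝ) ^ (-(a - 1)) * ∫ t in Ioi 0, scaledBetaPrimeKernel a n t := by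
  have hn0 : (0 : ℝ) < n := by exact_mod_cast hn
  have h := integral_comp_mul_left_Ioi (betaPrimeKernel a (n / 2)) 0 (inv_pos.2 hn0)
  rw [mul_zero, inv_inv, smul_eq_mul, setIntegral_congr_fun measurableSet_Ioi
    (fun t ht => betaPrimeKernel_inv_mul hn ht), integral_const_mul] at h
  rw [mul_assoc, h, betaPrimeMass, inv_mul_cancel_left₀ hn0.ne']

lemma integral_betaPrimeKernel_eq_scaled {a l u : ℝ} {n : ℕ} (hn : 0 < n) (hl : 0 ≤ l)
    (hlu : l ≤ u) :
    ∫ y in l..u, betaPrimeKernel a (n / 2) y =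
      (n : ℝ)⁻¹ * (n : ℝ) ^ (-(a - 1)) * ∫ t in (n * l)..(n * u), scaledBetaPrimeKernel a n t := by
  have hn0 : (0 : ℝ) < n := by exact_mod_cast hn
  have h := intervalIntegral.integral_comp_mul_left (a := n * l) (b := n * u)
    (betaPrimeKernel a (n / 2)) (inv_pos.2 hn0).ne'
  rw [inv_inv, inv_mul_cancel_left₀ hn0.ne', inv_mul_cancel_left₀ hn0.ne', smul_eq_mul] at h
  have h2 : ∫ t in (n * l)..(n * u), betaPrimeKernel a (n / 2) ((n : ℝ)⁻¹ * t) =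
      (n : ℝ) ^ (-(a - 1)) * ∫ t in (n * l)..(n * u), scaledBetaPrimeKernel a n t := by
    rw [← intervalIntegral.integral_const_mul]
    have hle : n * l ≤ n * u := by gcongr
    rw [intervalIntegral.integral_of_le hle, intervalIntegral.integral_of_le hle]
    exact setIntegral_congr_fun measurableSet_Ioc fun t ht =>
      betaPrimeKernel_inv_mul hn (lt_of_le_of_lt (by positivity) ht.1)
  rw [mul_assoc, ← h2, h, inv_mul_cancel_left₀ hn0.ne']

lemma tendsto_scaledBetaPrimeKernel {a t : ℝ} (ht : 0 < t) :
    Tendsto (fun n => scaledBetaPrimeKernel a n t) atTop (𝓝 (chiSquaredKernel a t)) := by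
  have h1 := Real.tendsto_one_add_div_pow_exp t
  have h2 : Tendsto (fun n : ℕ => 1 + t / n) atTop (𝓝 (1 + 0)) :=
    (tendsto_const_div_atTop_nhds_zero_nat t).const_add 1
  have h3 := (h2.rpow_const (p := -a) (Or.inl (by norm_num))).mul
    (h1.rpow_const (p := -(1 / 2)) (Or.inl (Real.exp_pos t).ne'))
  have h4 := h3.const_mul (t ^ (a - 1))
  have h5 : t ^ (a - 1) * ((1 + 0) ^ (-a) * Real.exp t ^ (-(1 / 2 : ℝ))) =
      chiSquaredKernel a t := by
    rw [chiSquaredKernel, ← Real.exp_mul, add_zero, Real.one_rpow, one_mul]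
    congr 2; ring
  rw [h5] at h4
  refine h4.congr fun n => ?_
  have h6 : 0 < 1 + t / n := by positivity
  rw [scaledBetaPrimeKernel, ← Real.rpow_natCast, ← Real.rpow_mul h6.le, ← Real.rpow_add h6]
  congr 2; ring

/-- Bernoulli's inequality makes the case `n = 5` a dominating function. -/
lemma scaledBetaPrimeKernel_le {a t : ℝ} {n : ℕ} (ha : 0 < a) (hn : 5 ≤ n) (ht : 0 < t) :
    scaledBetaPrimeKernel a n t ≤ t ^ (a - 1) * (1 + 1 / 5 * t) ^ (-(5 / 2 : ℝ)) := by
  have hn0 : (5 : ℝ) ≤ n := by exact_mod_cast hn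
  have hn1 : (0 : ℝ) < n := by linarith
  have h0 : 0 < 1 + t / n := by positivity
  rw [scaledBetaPrimeKernel]
  gcongr ?_ * ?_
  have h1 : 1 + 1 / 5 * t ≤ (1 + t / n) ^ ((n : ℝ) / 5) := by
    have := one_add_mul_self_le_rpow_one_add (s := t / n) (by linarith) (p := (n : ℝ) / 5)
      (by linarith)
    refine le_trans (le_of_eq ?_) this
    field_simp
  calc (1 + t / n) ^ (-(a + n / 2)) ≤ (1 + t / n) ^ (-(n / 2 : ℝ)) :=
        Real.rpow_le_rpow_of_exponent_le (by linarith [div_pos ht hn1]) (by linarith)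
    _ = ((1 + t / n) ^ ((n : ℝ) / 5)) ^ (-(5 / 2 : ℝ)) := by
        rw [← Real.rpow_mul h0.le]; congr 1; ring
    _ ≤ (1 + 1 / 5 * t) ^ (-(5 / 2 : ℝ)) :=
        Real.rpow_le_rpow_of_nonpos (by positivity) h1 (by norm_num)

lemma integrableOn_dominating {a : ℝ} (ha : 0 < a) (ha2 : a ≤ 2) :
    IntegrableOn (fun t : ℝ => t ^ (a - 1) * (1 + 1 / 5 * t) ^ (-(5 / 2 : ℝ))) (Ioi 0) := by
  have h := integrableOn_betaPrimeKernel (a := a) (b := 5 / 2 - a) ha (by linarith)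
  rw [← mul_zero (1 / 5 : ℝ), ← integrableOn_Ioi_comp_mul_left_iff _ _ (by norm_num)] at h
  refine IntegrableOn.congr_fun (h.const_mul (((1 / 5 : ℝ) ^ (a - 1))⁻¹)) (fun t ht => ?_)
    measurableSet_Ioi
  have ht : 0 < t := ht
  simp only [betaPrimeKernel]
  rw [Real.mul_rpow (by norm_num) ht.le, show -(a + (5 / 2 - a)) = -(5 / 2 : ℝ) by ring]
  have : (1 / 5 : ℝ) ^ (a - 1) ≠ 0 := by positivity
  field_simp

lemma norm_scaledBetaPrimeKernel_le {a t : ℝ} {n : ℕ} (ha : 0 < a) (hn : 5 ≤ n) (ht : 0 < t) :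
    ‖scaledBetaPrimeKernel a n t‖ ≤ t ^ (a - 1) * (1 + 1 / 5 * t) ^ (-(5 / 2 : ℝ)) := by
  rw [Real.norm_of_nonneg]
  · exact scaledBetaPrimeKernel_le ha hn ht
  · unfold scaledBetaPrimeKernel; positivity

lemma measurable_scaledBetaPrimeKernel (a : ℝ) (n : ℕ) :
    Measurable (scaledBetaPrimeKernel a n) := by
  unfold scaledBetaPrimeKernel; fun_prop

lemma tendsto_integral_scaledBetaPrimeKernel {a : ℝ} (ha : 0 < a) (ha2 : a ≤ 2) :
    Tendsto (fun n : ℕ => ∫ t in Ioi 0, scaledBetaPrimeKernel a n t) atTop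
      (𝓝 (∫ t in Ioi 0, chiSquaredKernel a t)) := by
  refine tendsto_integral_filter_of_dominated_convergence _
    (Eventually.of_forall fun n => (measurable_scaledBetaPrimeKernel a n).aestronglyMeasurable)
    ?_ (integrableOn_dominating ha ha2) ?_
  · filter_upwards [eventually_ge_atTop 5] with n hn
    filter_upwards [ae_restrict_mem measurableSet_Ioi] with t ht
      using norm_scaledBetaPrimeKernel_le ha hn ht
  · filter_upwards [ae_restrict_mem measurableSet_Ioi] with t ht
      using tendsto_scaledBetaPrimeKernel ht

lemma tendsto_intervalIntegral_scaledBetaPrimeKernel {a : ℝ} (ha : 0 < a) (ha2 : a ≤ 2)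
    {l u : ℕ → ℝ} {L U : ℝ} (hl : Tendsto l atTop (𝓝 L)) (hu : Tendsto u atTop (𝓝 U))
    (hl0 : ∀ᶠ n in atTop, 0 ≤ l n) (hlu : ∀ᶠ n in atTop, l n ≤ u n) :
    Tendsto (fun n : ℕ => ∫ t in (l n)..(u n), scaledBetaPrimeKernel a n t) atTop
      (𝓝 (∫ t in L..U, chiSquaredKernel a t)) := by
  have hL : 0 ≤ L := ge_of_tendsto hl hl0
  have hLU : L ≤ U := le_of_tendsto_of_tendsto hl hu hlu
  have key : ∀ (f : ℝ → ℝ) {x y : ℝ}, 0 ≤ x → x ≤ y →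
      ∫ t in x..y, f t = ∫ t in Ioi 0, (Ioc x y).indicator f t := by
    intro f x y hx hxy
    rw [setIntegral_indicator measurableSet_Ioc, intervalIntegral.integral_of_le hxy,
      inter_eq_self_of_subset_right]
    exact fun t ht => hx.trans_lt ht.1
  rw [key _ hL hLU]
  have hev : (fun n : ℕ => ∫ t in Ioi 0, (Ioc (l n) (u n)).indicator (scaledBetaPrimeKernel a n) t)
      =ᶠ[atTop] fun n : ℕ => ∫ t in (l n)..(u n), scaledBetaPrimeKernel a n t := by
    filter_upwards [hl0, hlu] with n h1 h2 using (key _ h1 h2).symm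
  refine Tendsto.congr' hev (tendsto_integral_filter_of_dominated_convergence _
    (Eventually.of_forall fun n => ((measurable_scaledBetaPrimeKernel a n).indicator
      measurableSet_Ioc).aestronglyMeasurable) ?_ (integrableOn_dominating ha ha2) ?_)
  · filter_upwards [eventually_ge_atTop 5] with n hn
    filter_upwards [ae_restrict_mem measurableSet_Ioi] with t ht
      using (norm_indicator_le_norm_self _ _).trans (norm_scaledBetaPrimeKernel_le ha hn ht)
  · have hne : ∀ x : ℝ, ∀ᵐ t ∂(volume.restrict (Ioi (0 : ℝ))), t ≠ x := fun x =>
      ae_restrict_of_ae (compl_mem_ae_iff.2 (measure_singleton x))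
    -- Off the two endpoints of the limit interval the indicators are eventually constant.
    filter_upwards [ae_restrict_mem measurableSet_Ioi, hne L, hne U] with t ht htL htU
    by_cases hmem : t ∈ Ioc L U
    · rw [indicator_of_mem hmem]
      refine (tendsto_scaledBetaPrimeKernel ht).congr' ?_
      filter_upwards [hl.eventually_lt_const hmem.1,
        hu.eventually_const_lt (lt_of_le_of_ne hmem.2 htU)] with n h1 h2
      rw [indicator_of_mem (show t ∈ Ioc (l n) (u n) from ⟨h1, h2.le⟩)]
    · rw [indicator_of_notMem hmem]
      refine tendsto_const_nhds.congr' ?_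
      rcases lt_or_ge L t with h | h
      · have hU : U < t := lt_of_not_ge fun h' => hmem ⟨h, h'⟩
        filter_upwards [hu.eventually_lt_const hU] with n h1
        rw [indicator_of_notMem fun h' => not_lt.2 h'.2 h1]
      · filter_upwards [hl.eventually_const_lt (lt_of_le_of_ne h htL)] with n h1
        rw [indicator_of_notMem fun h' => not_lt.2 h1.le h'.1]

lemma tendsto_fCoeffVar {d : ℝ} (hd : 0 < d) :
    Tendsto (fun n : ℕ => fCoeffVar d n) atTop (𝓝 √(2 / d)) := by
  have h1 : Tendsto (fun n : ℕ => (n : ℝ) - 4) atTop atTop :=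
    tendsto_atTop_add_const_right _ (-4) tendsto_natCast_atTop_atTop
  have h2 : Tendsto (fun n : ℕ => 2 / d * (1 + (d + 2) / ((n : ℝ) - 4))) atTop
      (𝓝 (2 / d * (1 + 0))) := ((h1.const_div_atTop (d + 2)).const_add 1).const_mul _
  rw [add_zero, mul_one] at h2
  refine (h2.sqrt).congr' ?_
  filter_upwards [eventually_ge_atTop 5] with n hn
  have hn0 : (5 : ℝ) ≤ n := by exact_mod_cast hn
  have h4 : (n : ℝ) - 4 ≠ 0 := by linarith
  rw [fCoeffVar]
  congr 1
  field_simp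
  ring

lemma tendsto_natCast_mul_div {d x : ℝ} {f : ℕ → ℝ} (hf : Tendsto f atTop (𝓝 x)) :
    Tendsto (fun n : ℕ => (n : ℝ) * (d * f n / (n - 2))) atTop (𝓝 (d * x)) := by
  have h1 : Tendsto (fun n : ℕ => (n : ℝ) - 2) atTop atTop :=
    tendsto_atTop_add_const_right _ (-2) tendsto_natCast_atTop_atTop
  have h2 : Tendsto (fun n : ℕ => d * f n * (1 + 2 / ((n : ℝ) - 2))) atTop
      (𝓝 (d * x * (1 + 0))) := (hf.const_mul d).mul ((h1.const_div_atTop 2).const_add 1)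
  rw [add_zero, mul_one] at h2
  refine h2.congr' ?_
  filter_upwards [eventually_ge_atTop 5] with n hn
  have hn0 : (5 : ℝ) ≤ n := by exact_mod_cast hn
  have h4 : (n : ℝ) - 2 ≠ 0 := by linarith
  field_simp
  ring

/-- The one standard deviation probabilities of the `F`-distribution converge to that of `χ²(d)`
as the number of denominator degrees of freedom grows. -/
lemma tendsto_fProb {d : ℝ} (hd : 0 < d) (hd4 : d ≤ 4) :
    Tendsto (fun n : ℕ => fProb d n) atTop (𝓝 (chiSquaredProb d)) := by
  have hd2 : (0 : ℝ) < d / 2 := by positivity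
  have hsqrt : d * √(2 / d) = √(2 * d) := by
    rw [← Real.sqrt_sq hd.le, ← Real.sqrt_mul (sq_nonneg d), Real.sqrt_sq hd.le]
    congr 1; field_simp
  have hu : Tendsto (fun n : ℕ => (n : ℝ) * fUpper d n) atTop (𝓝 (d + √(2 * d))) := by
    rw [← hsqrt, show d + d * √(2 / d) = d * (1 + √(2 / d)) by ring]
    exact tendsto_natCast_mul_div ((tendsto_fCoeffVar hd).const_add 1)
  have hl : Tendsto (fun n : ℕ => (n : ℝ) * fLower d n) atTop (𝓝 (d - √(2 * d))) := by
    rw [← hsqrt, show d - d * √(2 / d) = d * (1 - √(2 / d)) by ring]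
    exact tendsto_natCast_mul_div ((tendsto_fCoeffVar hd).const_sub 1)
  have hl' : Tendsto (fun n : ℕ => (n : ℝ) * max (fLower d n) 0) atTop
      (𝓝 (max (d - √(2 * d)) 0)) := by
    refine (hl.max (tendsto_const_nhds (x := (0 : ℝ)))).congr fun n => ?_
    rw [mul_max_of_nonneg _ _ (Nat.cast_nonneg n), mul_zero]
  have hle : ∀ n : ℕ, 5 ≤ n → max (fLower d n) 0 ≤ fUpper d n := by
    intro n hn
    have hn0 : (5 : ℝ) ≤ n := by exact_mod_cast hn
    have h0 : 0 ≤ fCoeffVar d n := Real.sqrt_nonneg _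
    have h2 : (0 : ℝ) < n - 2 := by linarith
    refine max_le ?_ (div_nonneg (by positivity) h2.le)
    rw [fLower, fUpper]
    gcongr
    linarith
  have hI : 0 < ∫ x in Ioi 0, chiSquaredKernel (d / 2) x := by
    rw [integral_chiSquaredKernel hd2]
    have := Real.Gamma_pos_of_pos hd2
    positivity
  refine ((tendsto_intervalIntegral_scaledBetaPrimeKernel hd2 (by linarith) hl' hu
    (Eventually.of_forall fun n => by positivity) ?_).div
    (tendsto_integral_scaledBetaPrimeKernel hd2 (by linarith)) hI.ne').congr' ?_
  · filter_upwards [eventually_ge_atTop 5] with n hn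
    exact mul_le_mul_of_nonneg_left (hle n hn) (by positivity)
  · filter_upwards [eventually_ge_atTop 5] with n hn
    have hn0 : (0 : ℝ) < n := by exact_mod_cast (by linarith : 0 < n)
    rw [fProb, integral_betaPrimeKernel_eq_scaled (by linarith) (le_max_right _ _) (hle n hn),
      betaPrimeMass_eq_scaled (by linarith), Pi.div_apply, mul_div_mul_left]
    positivity

/-! ### Numerical bounds -/

lemma sqrt_two_pi_bounds : 2.506627 < √(2 * Real.pi) ∧ √(2 * Real.pi) < 2.506629 := by
  have h1 := Real.pi_gt_d6
  have h2 := Real.pi_lt_d6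
  constructor
  · apply Real.lt_sqrt_of_sq_lt; norm_num at *; linarith
  · rw [Real.sqrt_lt' (by norm_num)]; norm_num at *; linarith

lemma abs_exp_neg_sub_le {y : ℝ} (h0 : 0 ≤ y) (h1 : y ≤ 1 / 2) :
    |Real.exp (-y) - (1 - y + y ^ 2 / 2 - y ^ 3 / 6 + y ^ 4 / 24 - y ^ 5 / 120 + y ^ 6 / 720)| ≤
      1 / 500000 := by
  have h := Real.exp_bound (x := -y) (by rw [abs_neg, abs_of_nonneg h0]; linarith)
    (n := 7) (by norm_num)
  rw [abs_neg, abs_of_nonneg h0] at h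
  have h2 : y ^ 7 ≤ (1 / 2) ^ 7 := pow_le_pow_left₀ h0 h1 7
  norm_num [Finset.sum_range_succ, Nat.factorial] at h
  rw [show Real.exp (-y) -
    (1 - y + y ^ 2 / 2 - y ^ 3 / 6 + y ^ 4 / 24 - y ^ 5 / 120 + y ^ 6 / 720) = Real.exp (-y) -
    (1 + -y + y ^ 2 / 2 + (-y) ^ 3 / 6 + y ^ 4 / 24 + (-y) ^ 5 / 120 + y ^ 6 / 720) by ring]
  refine h.trans ?_
  norm_num at h2
  linarith

lemma integral_exp_neg_sq_half_bounds :
    |(∫ x in (-1 : ℝ)..1, Real.exp (-(x ^ 2 / 2))) - 1.7112488| ≤ 1 / 200000 := by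
  let p : ℝ → ℝ := fun x => 1 - x ^ 2 / 2 + x ^ 4 / 8 - x ^ 6 / 48 + x ^ 8 / 384 - x ^ 10 / 3840 +
    x ^ 12 / 46080
  have hp : ∫ x in (-1 : ℝ)..1, p x = 2 * (1 - 1 / 6 + 1 / 40 - 1 / 336 + 1 / 3456 - 1 / 42240 +
      1 / 599040) := by
    have hd : ∀ x ∈ uIcc (-1 : ℝ) 1, HasDerivAt (fun x : ℝ => x - x ^ 3 / 6 + x ^ 5 / 40 -
        x ^ 7 / 336 + x ^ 9 / 3456 - x ^ 11 / 42240 + x ^ 13 / 599040) (p x) x := by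
      intro x _
      have h : ∀ (k : ℕ) (c : ℝ), HasDerivAt (fun x : ℝ => x ^ k / c) (k * x ^ (k - 1) / c) x :=
        fun k c => (hasDerivAt_pow k x).div_const c
      refine (((((((hasDerivAt_id x).sub (h 3 6)).add (h 5 40)).sub (h 7 336)).add
        (h 9 3456)).sub (h 11 42240)).add (h 13 599040)).congr_deriv ?_
      simp only [p]; norm_num; ring
    rw [intervalIntegral.integral_eq_sub_of_hasDerivAt hd
      (Continuous.intervalIntegrable (by fun_prop) _ _)]
    norm_num
  have hint : IntervalIntegrable (fun x : ℝ => Real.exp (-(x ^ 2 / 2))) volume (-1) 1 :=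
    Continuous.intervalIntegrable (by fun_prop) _ _
  have hpint : IntervalIntegrable p volume (-1) 1 :=
    Continuous.intervalIntegrable (by fun_prop) _ _
  have hdiff := intervalIntegral.norm_integral_le_of_norm_le_const (a := -1) (b := 1)
    (f := fun x : ℝ => Real.exp (-(x ^ 2 / 2)) - p x) (C := 1 / 500000) (by
      intro x hx
      rw [uIoc_of_le (by norm_num)] at hx
      have hx2 : x ^ 2 ≤ 1 := by nlinarith [hx.1, hx.2]
      have := abs_exp_neg_sub_le (y := x ^ 2 / 2) (by positivity) (by linarith)
      rw [Real.norm_eq_abs]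
      refine le_of_eq_of_le ?_ this
      congr 2
      simp only [p]; ring)
  rw [intervalIntegral.integral_sub hint hpint, hp, Real.norm_eq_abs] at hdiff
  rw [abs_le] at hdiff ⊢
  norm_num at hdiff ⊢
  constructor <;> linarith [hdiff.1, hdiff.2]

lemma gaussianReal_within_one :
    (gaussianReal 0 1).real {x : ℝ | |x| ≤ 1} =
      (∫ x in (-1 : ℝ)..1, Real.exp (-(x ^ 2 / 2))) / √(2 * Real.pi) := by
  have hset : {x : ℝ | |x| ≤ 1} = Icc (-1) 1 := by
    ext x
    exact abs_le (a := x) (b := (1 : ℝ))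
  rw [hset, measureReal_def, gaussianReal_apply_eq_integral _ one_ne_zero,
    ENNReal.toReal_ofReal (setIntegral_nonneg measurableSet_Icc fun x _ =>
      gaussianPDFReal_nonneg _ _ _), integral_Icc_eq_integral_Ioc,
    ← intervalIntegral.integral_of_le (by norm_num), ← intervalIntegral.integral_div]
  refine intervalIntegral.integral_congr fun x _ => ?_
  simp only [gaussianPDFReal, NNReal.coe_one, mul_one, sub_zero]
  rw [neg_div, div_eq_inv_mul _ √(2 * Real.pi)]

lemma abs_gaussianReal_within_one_sub_lt :
    |(gaussianReal 0 1).real {x : ℝ | |x| ≤ 1} - 0.6827| < 0.00005 := by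
  obtain ⟨h1, h2⟩ := sqrt_two_pi_bounds
  obtain ⟨h3, h4⟩ := abs_le.1 integral_exp_neg_sq_half_bounds
  have h0 : 0 < √(2 * Real.pi) := by linarith
  rw [gaussianReal_within_one, abs_lt]
  constructor
  · rw [lt_sub_iff_add_lt, lt_div_iff₀ h0]
    norm_num at *
    linarith
  · rw [sub_lt_iff_lt_add, div_lt_iff₀ h0]
    norm_num at *
    linarith

/-- A lower bound for `chiSquaredProb d` from an explicit primitive `Φ` of a minorant `g` of the
density on a subinterval `[p, q]`. -/
lemma lt_chiSquaredProb_of_primitive {d p q : ℝ} {g Φ : ℝ → ℝ} (hd : 0 < d)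
    (hp : 0 ≤ p) (hpq : p ≤ q) (hl : d - √(2 * d) ≤ p) (hu : q ≤ d + √(2 * d))
    (hg : ∀ x ∈ Icc p q, g x ≤ chiSquaredKernel (d / 2) x)
    (hgc : ContinuousOn g (Icc p q)) (hΦ : ∀ x ∈ Icc p q, HasDerivAt Φ (g x) x)
    (h : 0.683 * (2 ^ (d / 2) * Real.Gamma (d / 2)) < Φ q - Φ p) :
    0.683 < chiSquaredProb d := by
  have ha : (0 : ℝ) < d / 2 := by positivity
  have hΓ := Real.Gamma_pos_of_pos ha
  rw [chiSquaredProb, integral_chiSquaredKernel ha, lt_div_iff₀ (by positivity)]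
  refine h.trans_le ?_
  rw [← uIcc_of_le hpq] at hgc hΦ
  rw [← intervalIntegral.integral_eq_sub_of_hasDerivAt hΦ hgc.intervalIntegrable]
  have hint : ∀ x y : ℝ, 0 ≤ x → 0 ≤ y →
      IntervalIntegrable (chiSquaredKernel (d / 2)) volume x y := by
    intro x y hx hy
    rw [intervalIntegrable_iff]
    exact (integrableOn_chiSquaredKernel ha).mono_set fun t ht => lt_of_le_of_lt (le_min hx hy) ht.1
  refine (intervalIntegral.integral_mono_on hpq hgc.intervalIntegrable
    (hint p q hp (hp.trans hpq)) hg).trans ?_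
  refine intervalIntegral.integral_mono_interval (max_le hl hp) hpq hu ?_ (hint _ _
    (le_max_right _ _) (by positivity))
  filter_upwards [ae_restrict_mem measurableSet_Ioc] with x hx
  have hx0 : 0 < x := (le_max_right _ _).trans_lt hx.1
  show 0 ≤ chiSquaredKernel (d / 2) x
  unfold chiSquaredKernel
  positivity

lemma lt_chiSquaredProb_one : 0.683 < chiSquaredProb 1 := by
  have hs2 : 1.4 < √(2 * (1 : ℝ)) := by
    apply Real.lt_sqrt_of_sq_lt; norm_num
  refine lt_chiSquaredProb_of_primitive (p := 1 / 400) (q := 49 / 25) one_pos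
    (g := fun x => (√x)⁻¹ * (1 - x / 2)) (Φ := fun x => √x * (2 - x / 3)) (by norm_num)
    (by norm_num) ?_ ?_ ?_ ?_ ?_ ?_
  · linarith
  · linarith
  · intro x hx
    have hx0 : 0 < x := lt_of_lt_of_le (by norm_num) hx.1
    rw [chiSquaredKernel, show (1 : ℝ) / 2 - 1 = -(1 / 2) by norm_num,
      Real.rpow_neg hx0.le, ← Real.sqrt_eq_rpow]
    have := Real.add_one_le_exp (-(1 / 2 * x))
    gcongr
    linarith
  · intro x hx
    have hx0 : 0 < x := lt_of_lt_of_le (by norm_num) hx.1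
    have : √x ≠ 0 := by positivity
    exact ContinuousAt.continuousWithinAt (by fun_prop (disch := assumption))
  · intro x hx
    have hx0 : 0 < x := lt_of_lt_of_le (by norm_num) hx.1
    refine ((Real.hasDerivAt_sqrt hx0.ne').mul
      (((hasDerivAt_id x).div_const 3).const_sub 2)).congr_deriv ?_
    have h2 : √x ^ 2 = x := Real.sq_sqrt hx0.le
    have h3 : √x ≠ 0 := by positivity
    simp only [id]
    field_simp
    rw [h2]
    ring
  · have e1 : √(49 / 25 : ℝ) = 7 / 5 := by
      rw [show (49 / 25 : ℝ) = (7 / 5) ^ 2 by norm_num, Real.sqrt_sq (by norm_num)]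
    have e2 : √(1 / 400 : ℝ) = 1 / 20 := by
      rw [show (1 / 400 : ℝ) = (1 / 20) ^ 2 by norm_num, Real.sqrt_sq (by norm_num)]
    have e3 : (2 : ℝ) ^ ((1 : ℝ) / 2) * Real.Gamma ((1 : ℝ) / 2) =
        √(2 * Real.pi) := by
      rw [Real.Gamma_one_half_eq, ← Real.sqrt_eq_rpow,
        Real.sqrt_mul (by norm_num)]
    simp only [e1, e2, e3]
    have := sqrt_two_pi_bounds.2
    norm_num at *
    linarith

lemma hasDerivAt_exp_neg_half (x : ℝ) : HasDerivAt (fun x : ℝ => Real.exp (-(1 / 2 * x)))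
    (Real.exp (-(1 / 2 * x)) * (-(1 / 2))) x := by
  have h : HasDerivAt (fun x : ℝ => -(1 / 2 * x)) (-(1 / 2)) x := by
    exact ((hasDerivAt_id x).const_mul (1 / 2 : ℝ)).neg.congr_deriv (by ring)
  exact h.exp

lemma lt_chiSquaredProb_two : 0.683 < chiSquaredProb 2 := by
  have hs2 : √(2 * (2 : ℝ)) = 2 := by
    rw [show 2 * (2 : ℝ) = 2 ^ 2 by norm_num, Real.sqrt_sq (by norm_num)]
  refine lt_chiSquaredProb_of_primitive (p := 0) (q := 4) two_pos
    (g := fun x => Real.exp (-(1 / 2 * x))) (Φ := fun x => -2 * Real.exp (-(1 / 2 * x))) le_rfl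
    (by norm_num) ?_ ?_ ?_ (by fun_prop) ?_ ?_
  · rw [hs2]; norm_num
  · rw [hs2]; norm_num
  · intro x hx
    simp [chiSquaredKernel]
  · intro x hx
    exact ((hasDerivAt_exp_neg_half x).const_mul (-2)).congr_deriv (by ring)
  · have h1 : Real.exp (-(1 / 2 * 4)) ≤ 1 / 4 := by
      rw [show -(1 / 2 * 4 : ℝ) = -(1 + 1) by norm_num, Real.exp_neg, Real.exp_add, ← one_div]
      have := Real.exp_one_gt_d9
      apply one_div_le_one_div_of_le (by norm_num)
      nlinarith
    norm_num [Real.Gamma_one] at *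
    linarith

lemma lt_chiSquaredProb_three : 0.683 < chiSquaredProb 3 := by
  have hs2 : 2.44 < √(2 * (3 : ℝ)) := by
    apply Real.lt_sqrt_of_sq_lt; norm_num
  -- On the interval, `exp (-x / 2) = exp (-1) * exp (-(x - 2) / 2)` is minorised through
  -- `(1 - t / 4) ^ 4 ≤ exp (-t)` with `t = (x - 2) / 2`.
  refine lt_chiSquaredProb_of_primitive (p := 9 / 16) (q := 81 / 16) three_pos
    (g := fun x => √x * (0.3678 * (1 - (x - 2) / 8) ^ 4))
    (Φ := fun x => √x * (x * (0.3678 / 4096 * (10000 * (2 / 3) - 4000 * (2 / 5) * x +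
      600 * (2 / 7) * x ^ 2 - 40 * (2 / 9) * x ^ 3 + (2 / 11) * x ^ 4)))) (by norm_num)
    (by norm_num) ?_ ?_ ?_ ?_ ?_ ?_
  · linarith
  · linarith
  · intro x hx
    have hx0 : 0 < x := lt_of_lt_of_le (by norm_num) hx.1
    rw [chiSquaredKernel, show (3 : ℝ) / 2 - 1 = 1 / 2 by norm_num, ← Real.sqrt_eq_rpow]
    have h1 := Real.one_sub_div_pow_le_exp_neg (n := 4) (t := (x - 2) / 2)
      (by have := hx.2; push_cast; linarith)
    have h2 : (0.3678 : ℝ) ≤ Real.exp (-1) := by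
      rw [Real.exp_neg, ← one_div, le_div_iff₀ (Real.exp_pos 1)]
      have := Real.exp_one_lt_d9
      norm_num at *
      linarith
    rw [show -(1 / 2 * x) = -1 + -((x - 2) / 2) by ring, Real.exp_add]
    have h3 : (x - 2) / 2 / ((4 : ℕ) : ℝ) = (x - 2) / 8 := by push_cast; ring
    rw [h3] at h1
    gcongr
  · exact Continuous.continuousOn (by fun_prop)
  · intro x hx
    have hx0 : 0 < x := lt_of_lt_of_le (by norm_num) hx.1
    have h : ∀ (k : ℕ) (c : ℝ), HasDerivAt (fun x : ℝ => c * x ^ k) (c * (k * x ^ (k - 1))) x :=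
      fun k c => (hasDerivAt_pow k x).const_mul c
    refine ((Real.hasDerivAt_sqrt hx0.ne').mul ((hasDerivAt_id x).mul
      ((((((((hasDerivAt_id x).const_mul (4000 * (2 / 5))).const_sub (10000 * (2 / 3))).add
        (h 2 (600 * (2 / 7)))).sub (h 3 (40 * (2 / 9)))).add
        (h 4 (2 / 11))).const_mul (0.3678 / 4096))))).congr_deriv ?_
    have h2 : √x ^ 2 = x := Real.sq_sqrt hx0.le
    have h3 : √x ≠ 0 := by positivity
    simp only [id]
    norm_num
    field_simp
    rw [h2]
    ring
  · have e1 : √(81 / 16 : ℝ) = 9 / 4 := by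
      rw [show (81 / 16 : ℝ) = (9 / 4) ^ 2 by norm_num, Real.sqrt_sq (by norm_num)]
    have e2 : √(9 / 16 : ℝ) = 3 / 4 := by
      rw [show (9 / 16 : ℝ) = (3 / 4) ^ 2 by norm_num, Real.sqrt_sq (by norm_num)]
    have e3 : (2 : ℝ) ^ ((3 : ℝ) / 2) * Real.Gamma ((3 : ℝ) / 2) =
        √(2 * Real.pi) := by
      rw [show (3 : ℝ) / 2 = 1 / 2 + 1 by norm_num, Real.Gamma_add_one (by norm_num),
        Real.Gamma_one_half_eq, Real.rpow_add_one (by norm_num), ← Real.sqrt_eq_rpow,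
        Real.sqrt_mul (by norm_num)]
      ring
    simp only [e1, e2, e3]
    have := sqrt_two_pi_bounds.2
    norm_num at *
    linarith

lemma lt_chiSquaredProb_four : 0.683 < chiSquaredProb 4 := by
  have hs2 : 2.8 < √(2 * (4 : ℝ)) := by
    apply Real.lt_sqrt_of_sq_lt; norm_num
  refine lt_chiSquaredProb_of_primitive (p := 6 / 5) (q := 34 / 5) four_pos
    (g := fun x => x * Real.exp (-(1 / 2 * x)))
    (Φ := fun x => -2 * (x + 2) * Real.exp (-(1 / 2 * x))) (by norm_num)
    (by norm_num) ?_ ?_ ?_ (by fun_prop) ?_ ?_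
  · linarith
  · linarith
  · intro x hx
    rw [chiSquaredKernel, show (4 : ℝ) / 2 - 1 = 1 by norm_num, Real.rpow_one]
  · intro x hx
    refine ((((hasDerivAt_id x).add_const 2).const_mul (-2)).mul
      (hasDerivAt_exp_neg_half x)).congr_deriv ?_
    simp only [id]; ring
  · have h1 : 0.54 ≤ Real.exp (-(1 / 2 * (6 / 5))) := by
      have := Real.one_sub_div_pow_le_exp_neg (n := 15) (t := 1 / 2 * (6 / 5)) (by norm_num)
      refine le_trans ?_ this
      norm_num
    have h2 : Real.exp (-(1 / 2 * (34 / 5))) ≤ 1 / 28 := by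
      rw [show -(1 / 2 * (34 / 5) : ℝ) = -(1 + 1 + 1 + 2 / 5) by norm_num, Real.exp_neg,
        Real.exp_add, Real.exp_add, Real.exp_add, ← one_div]
      apply one_div_le_one_div_of_le (by norm_num)
      have h3 : 2.718 ≤ Real.exp 1 := by
        have := Real.exp_one_gt_d9
        norm_num at *
        linarith
      have h4 := Real.add_one_le_exp (2 / 5 : ℝ)
      calc (28 : ℝ) ≤ 2.718 * 2.718 * 2.718 * (2 / 5 + 1) := by norm_num
        _ ≤ _ := by gcongr
    have e3 : (2 : ℝ) ^ ((4 : ℝ) / 2) * Real.Gamma ((4 : ℝ) / 2) = 4 := by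
      rw [show (4 : ℝ) / 2 = 1 + 1 by norm_num, Real.Gamma_add_one one_ne_zero,
        Real.Gamma_one, Real.rpow_add_one two_ne_zero]
      norm_num
    simp only [e3]
    norm_num at *
    linarith

lemma lt_chiSquaredProb {d : ℕ} (hd : d ∈ ({1, 2, 3, 4} : Set ℕ)) : 0.683 < chiSquaredProb d := by
  rcases hd with rfl | rfl | rfl | rfl <;> push_cast
  exacts [lt_chiSquaredProb_one, lt_chiSquaredProb_two, lt_chiSquaredProb_three,
    lt_chiSquaredProb_four]

/-! ### The infimum -/

lemma fProb_add_two_le {d : ℕ} (hd : d ∈ ({1, 2, 3, 4} : Set ℕ)) {n : ℝ} (hn : 5 ≤ n) :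
    fProb d (n + 2) ≤ fProb d n := by
  have hd0 : (0 : ℝ) < d := by
    rcases hd with rfl | rfl | rfl | rfl <;> norm_num
  have hU : ∀ m : ℝ, 5 ≤ m → 0 ≤ fUpper d m := fun m hm =>
    div_nonneg (mul_nonneg hd0.le (add_nonneg zero_le_one (Real.sqrt_nonneg _))) (by linarith)
  unfold fProb
  rw [← betaPrimeCDF_sub (by positivity) (by linarith) (hU _ (by linarith)) (le_max_right _ _),
    ← betaPrimeCDF_sub (by positivity) (by linarith) (hU _ hn) (le_max_right _ _)]
  linarith [betaPrimeCDF_fUpper_le hd hn, betaPrimeCDF_fLower_le hd hn]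

/-- Along `n, n + 2, n + 4, …` the probabilities decrease to their limit. -/
lemma chiSquaredProb_le_fProb {d : ℕ} (hd : d ∈ ({1, 2, 3, 4} : Set ℕ)) {n : ℕ} (hn : 5 ≤ n)
    (hlim : Tendsto (fun n : ℕ => fProb d n) atTop (𝓝 (chiSquaredProb d))) :
    chiSquaredProb d ≤ fProb d n := by
  have hn0 : (5 : ℝ) ≤ n := by exact_mod_cast hn
  have hanti : Antitone fun k : ℕ => fProb d ((n + 2 * k : ℕ) : ℝ) := by
    refine antitone_nat_of_succ_le fun k => ?_
    have := fProb_add_two_le hd (n := ((n + 2 * k : ℕ) : ℝ)) (by push_cast; linarith)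
    refine le_of_eq_of_le ?_ this
    congr 1; push_cast; ring
  have hsub : Tendsto (fun k : ℕ => n + 2 * k) atTop atTop :=
    tendsto_atTop_mono (fun k => by simp only [id]; omega) tendsto_id
  exact hanti.le_of_tendsto (hlim.comp hsub) 0

end

theorem theorem1p1 (d₁ : ℕ) (hd₁ : d₁ ∈ ({1, 2, 3, 4} : Set ℕ))
    {Ω : ℕ → Type*} [∀ d₂, MeasurableSpace (Ω d₂)]
    (P : ∀ d₂, Measure (Ω d₂)) [∀ d₂, IsProbabilityMeasure (P d₂)]
    (X : ∀ d₂, Ω d₂ → ℝ) (hX : ∀ d₂, 5 ≤ d₂ → HasLaw (X d₂) (fMeasure d₁ d₂) (P d₂))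
    {Ω' : Type*} [MeasurableSpace Ω'] (Q : Measure Ω') [IsProbabilityMeasure Q]
    (Z : Ω' → ℝ) (hZ : HasLaw Z (gaussianReal 0 1) Q)
    {Ω'' : Type*} [MeasurableSpace Ω''] (R : Measure Ω'') [IsProbabilityMeasure R]
    (Γ : Ω'' → ℝ) (hΓ : HasLaw Γ (chiSquaredMeasure d₁) R) :
    (∀ d₂, 5 ≤ d₂ → MemLp (X d₂) 2 (P d₂)) ∧
    MemLp Γ 2 R ∧
    (∀ d₂, 5 ≤ d₂ → Q.real {ω | |Z ω| ≤ 1} < probWithinOneSD (X d₂) (P d₂)) ∧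
    |Q.real {ω | |Z ω| ≤ 1} - 0.6827| < 0.00005 ∧
    IsGLB ((fun d₂ => probWithinOneSD (X d₂) (P d₂)) '' {d₂ | 5 ≤ d₂})
      (probWithinOneSD Γ R) := by
  have hd0 : 0 < d₁ := by rcases hd₁ with rfl | rfl | rfl | rfl <;> norm_num
  have hd4 : (d₁ : ℝ) ≤ 4 := by rcases hd₁ with rfl | rfl | rfl | rfl <;> norm_num
  have hF : ∀ n : ℕ, 5 ≤ n → MemLp id 2 (fMeasure d₁ n) ∧
      probWithinOneSD (X n) (P n) = fProb d₁ n := by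
    intro n hn
    have : IsProbabilityMeasure (fMeasure d₁ n) := (hX n hn).isProbabilityMeasure_iff.1 inferInstance
    rw [probWithinOneSD_eq_of_hasLaw (hX n hn)]
    exact memLp_and_probWithinOneSD_fMeasure hd0 hn
  obtain ⟨hΓ2, hΓp⟩ := memLp_and_probWithinOneSD_chiSquaredMeasure hd0
  have hΓprob : probWithinOneSD Γ R = chiSquaredProb d₁ := by
    rw [probWithinOneSD_eq_of_hasLaw hΓ]
    exact hΓp
  have hZprob : Q.real {ω | |Z ω| ≤ 1} = (gaussianReal 0 1).real {x : ℝ | |x| ≤ 1} :=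
    hZ.measureReal_eq (p := fun x => |x| ≤ 1) (measurableSet_le (by fun_prop) measurable_const)
  have hlim : Filter.Tendsto (fun n : ℕ => fProb d₁ n) Filter.atTop (nhds (chiSquaredProb d₁)) :=
    tendsto_fProb (by exact_mod_cast hd0) hd4
  have hle : ∀ n : ℕ, 5 ≤ n → chiSquaredProb d₁ ≤ fProb d₁ n := fun n hn =>
    chiSquaredProb_le_fProb hd₁ hn hlim
  have hgauss := abs_gaussianReal_within_one_sub_lt
  refine ⟨fun n hn => ?_, ?_, fun n hn => ?_, ?_, ?_, ?_⟩
  · exact memLp_of_hasLaw (hX n hn) (hF n hn).1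
  · exact memLp_of_hasLaw hΓ hΓ2
  · rw [hZprob, (hF n hn).2]
    have h1 := (abs_lt.1 hgauss).2
    have h2 := lt_chiSquaredProb hd₁
    have h3 := hle n hn
    norm_num at h1 h2
    linarith
  · rw [hZprob]; exact hgauss
  · rintro _ ⟨n, hn, rfl⟩
    simp only
    rw [hΓprob, (hF n hn).2]
    exact hle n hn
  · intro x hx
    rw [hΓprob]
    refine ge_of_tendsto hlim ?_
    filter_upwards [Filter.eventually_ge_atTop 5] with n hn
    rw [← (hF n hn).2]
    exact hx ⟨n, hn, rfl⟩
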